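/- Let $D\subset\mathbb C$ be the open unit disk. A function $f$ on $D$ has a boundary value in the sense of distributions, $f_b\in\mathcal D'(\partial D)$, if $\langle f_b,\varphi\rangle:=\lim_{r\nearrow1}\int_0^{2\pi}f(re^{i\theta})\varphi(\theta)\,d\theta$ exists for every $\varphi\in C^\infty(\partial D)$; $H_b$ is the set of holomorphic functions on $D$ with a boundary value in the sense of distributions. For $u\in\mathcal D'(\partial D)$ put $\langle\bar u,\varphi\rangle=\overline{\langle u,\bar\varphi\rangle}$, $\operatorname{Re}u=(u+\bar u)/2$, $\operatorname{Im}u=(u-\bar u)/(2i)$. Let $P_r(\theta)=\frac{1-r^2}{1-2r\cos\theta+r^2}$. **Theorem.** Let $n$ be a positive integer, $q>2$, $A\in W^{n-1,q}(D)$, and let $h_0,\dots,h_{n-1}\in H_b$ and $c_0,\dots,c_{n-1}\in\mathbb R$. Put $$\psi(z)=-\frac1\pi\iint_D\frac{A(\zeta)}{\zeta-z}\,d\xi\,d\eta\quad(\zeta=\xi+i\eta),\qquad I_{k-1}=\frac{i}{2\pi}\langle\operatorname{Im}\{(h_{k-1})_b\},1\rangle ,$$ and define $f_0\equiv0$ and,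 recursively for $1\le k\le n$ and $z=re^{i\theta}\in D$, $$f_k(z)=ic_{k-1}-I_{k-1}+\frac1{2\pi}\langle(h_{k-1})_b,P_r(\theta-\cdot)\rangle-\sum_{\ell=1}^{k-1}\frac{(-1)^\ell}{\ell!}\bar z^\ell f_{k-\ell}(z).$$ Then, for $1\le k\le n$, the function $f_k$ is smooth on $D$, has a boundary value in the sense of distributions, and solves the Schwarz problem $$\frac{\partial f_k}{\partial\bar z}=f_{k-1},\qquad \operatorname{Re}\{(f_k)_b\}=\operatorname{Re}\Big\{(h_{k-1})_b-\sum_{\ell=1}^{k-1}\frac{(-1)^\ell}{\ell!}e^{-i\ell(\cdot)}(f_{k-\ell})_b\Big\},\qquad \operatorname{Im}\{f_k(0)\}=c_{k-1}.$$ Moreover, the function $$w(z)=e^{\psi(z)}\Big[ic_{n-1}-I_{n-1}+\frac1{2\pi}\langle(h_{n-1})_b,P_r(\theta-\cdot)\rangle-\sum_{\ell=1}^{n-1}\frac{(-1)^\ell}{\ell!}\bar z^\ell f_{n-\ell}(z)\Big]$$ solves, in the sense of weak derivatives on $D$, $$\Big(\frac{\partial}{\partial\bar z}-A\Big)^n w=0;$$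 its poly-analytic factor $w/e^{\psi}$ is smooth on $D$; and for $0\le k\le n-1$ the derivative $\frac{\partial^k}{\partial\bar z^k}\big(w/e^{\psi}\big)$ has a boundary value in the sense of distributions and satisfies $$\operatorname{Re}\Big\{\Big(\frac{\partial^k}{\partial\bar z^k}\frac{w}{e^{\psi}}\Big)_b\Big\}=\operatorname{Re}\{(f_{n-k})_b\}=\operatorname{Re}\Big\{(h_{n-1-k})_b-\sum_{\ell=1}^{n-k-1}\frac{(-1)^\ell}{\ell!}e^{-i\ell(\cdot)}(f_{n-k-\ell})_b\Big\},$$ $$\operatorname{Im}\Big\{\Big(\frac{\partial^k}{\partial\bar z^k}\frac{w}{e^{\psi}}\Big)(0)\Big\}=c_{n-1-k}.$$ -/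

import Mathlib

open MeasureTheory Filter Topology Set
open scoped ContDiff ENNReal BoundedContinuousFunction

noncomputable section

namespace SchwarzMeta

/-! ### Test functions and distributions on the circle -/

/-- Smooth functions on the unit circle, written as smooth `2π`-periodic functions of the angle. -/
def testSubmodule : Submodule ℂ (ℝ → ℂ) where
  carrier := {φ | ContDiff ℝ ∞ φ ∧ Function.Periodic φ (2 * Real.pi)}
  add_mem' := fun ha hb => ⟨ha.1.add hb.1, ha.2.add hb.2⟩
  zero_mem' := ⟨contDiff_const, fun _ => rfl⟩
  smul_mem' := fun c _ ha => ⟨contDiff_const.smul ha.1, fun x => congrArg (c • ·) (ha.2 x)⟩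

/-- The space `C^∞(∂D)` of test functions on the circle. -/
def CircleTest : Type := testSubmodule

instance : AddCommGroup CircleTest := inferInstanceAs (AddCommGroup testSubmodule)

instance : Module ℂ CircleTest := inferInstanceAs (Module ℂ testSubmodule)

instance : FunLike CircleTest ℝ ℂ := ⟨fun φ => φ.1, Subtype.val_injective⟩

/-- A test function from its values. -/
def CircleTest.mk (φ : ℝ → ℂ) (h : ContDiff ℝ ∞ φ) (hp : Function.Periodic φ (2 * Real.pi)) :
    CircleTest := ⟨φ, h, hp⟩

theorem CircleTest.contDiff (φ : CircleTest) : ContDiff ℝ ∞ φ := φ.2.1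

theorem CircleTest.periodic (φ : CircleTest) : Function.Periodic φ (2 * Real.pi) := φ.2.2

@[ext] theorem CircleTest.ext {φ χ : CircleTest} (h : ∀ t, φ t = χ t) : φ = χ :=
  Subtype.ext (funext h)

@[simp] theorem CircleTest.mk_apply (φ : ℝ → ℂ) (h : ContDiff ℝ ∞ φ)
    (hp : Function.Periodic φ (2 * Real.pi)) (t : ℝ) : CircleTest.mk φ h hp t = φ t := rfl

@[simp] theorem CircleTest.add_apply (φ χ : CircleTest) (t : ℝ) : (φ + χ) t = φ t + χ t := rfl

@[simp] theorem CircleTest.smul_apply (c : ℂ) (φ : CircleTest) (t : ℝ) : (c • φ) t = c * φ t := rfl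

theorem periodic_iteratedDeriv {φ : ℝ → ℂ} (hp : Function.Periodic φ (2 * Real.pi)) (j : ℕ) :
    Function.Periodic (iteratedDeriv j φ) (2 * Real.pi) := by
  intro x
  have h := iteratedDeriv_comp_add_const j φ (2 * Real.pi)
  have h2 : (fun z => φ (z + 2 * Real.pi)) = φ := funext hp
  rw [h2] at h
  exact (congrFun h x).symm

/-- The `j`-th derivative of a test function as a bounded continuous function. -/
def CircleTest.jet (φ : CircleTest) (j : ℕ) : ℝ →ᵇ ℂ :=
  BoundedContinuousFunction.mkOfBound
    ⟨iteratedDeriv j φ, φ.contDiff.continuous_iteratedDeriv j (by exact_mod_cast le_top)⟩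
    (Metric.diam (range (iteratedDeriv j φ)))
    (fun x y => Metric.dist_le_diam_of_mem
      ((periodic_iteratedDeriv φ.periodic j).isBounded_of_continuous (by positivity)
        (φ.contDiff.continuous_iteratedDeriv j (by exact_mod_cast le_top)))
      (mem_range_self x) (mem_range_self y))

@[simp] theorem CircleTest.jet_apply (φ : CircleTest) (j : ℕ) (t : ℝ) :
    φ.jet j t = iteratedDeriv j φ t := rfl

/-- All derivatives of a test function at once. -/
def jetMap : CircleTest →ₗ[ℂ] (ℕ → (ℝ →ᵇ ℂ)) where
  toFun φ := φ.jet
  map_add' φ χ := by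
    funext j
    ext t
    exact iteratedDeriv_add (φ.contDiff.contDiffAt.of_le (by exact_mod_cast le_top))
      (χ.contDiff.contDiffAt.of_le (by exact_mod_cast le_top))
  map_smul' c φ := by
    funext j
    ext t
    exact iteratedDeriv_const_smul_field c (φ : ℝ → ℂ)

/-- The topology (uniformity) of uniform convergence of all derivatives on `C^∞(∂D)`. -/
instance : UniformSpace CircleTest := UniformSpace.comap jetMap inferInstance

instance : IsUniformAddGroup CircleTest := IsUniformAddGroup.comap jetMap

instance : ContinuousSMul ℂ CircleTest := continuousSMul_induced jetMap

theorem isUniformInducing_jetMap : IsUniformInducing jetMap := ⟨rfl⟩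

theorem continuous_jet (j : ℕ) : Continuous fun φ : CircleTest => φ.jet j :=
  (continuous_apply j).comp isUniformInducing_jetMap.isInducing.continuous

theorem continuous_eval (t : ℝ) : Continuous fun φ : CircleTest => φ t := by
  have h := (continuous_eval_const (F := ℝ →ᵇ ℂ) t).comp (continuous_jet 0)
  simpa [Function.comp_def] using h

theorem continuous_pairing {f : ℝ → ℂ} {a b : ℝ} (hf : IntervalIntegrable f volume a b) :
    Continuous fun u : ℝ →ᵇ ℂ => ∫ t in a..b, f t * u t := by
  rw [continuous_iff_continuousAt]
  intro u
  refine intervalIntegral.continuousAt_of_dominated_interval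
    (bound := fun t => ‖f t‖ * (‖u‖ + 1)) (Eventually.of_forall fun v => ?_) ?_
    (hf.norm.mul_const _) (Eventually.of_forall fun t _ => ?_)
  · exact hf.def'.aestronglyMeasurable.mul v.continuous.aestronglyMeasurable
  · have : ∀ᶠ v : ℝ →ᵇ ℂ in 𝓝 u, ‖v‖ < ‖u‖ + 1 :=
      continuous_norm.continuousAt.eventually (gt_mem_nhds (lt_add_one _))
    filter_upwards [this] with v hv
    refine Eventually.of_forall fun t _ => ?_
    rw [norm_mul]
    exact mul_le_mul_of_nonneg_left ((v.norm_coe_le_norm t).trans hv.le) (norm_nonneg _)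
  · exact (continuous_const.mul (continuous_eval_const (F := ℝ →ᵇ ℂ) t)).continuousAt

theorem isClosed_range_jetMap : IsClosed (range jetMap) := by
  have key : range jetMap = {g : ℕ → (ℝ →ᵇ ℂ) |
      (∀ j x, g j x - g j 0 = ∫ t in (0:ℝ)..x, g (j + 1) t) ∧
      ∀ x, g 0 (x + 2 * Real.pi) = g 0 x} := by
    ext g
    constructor
    · rintro ⟨φ, rfl⟩
      refine ⟨fun j x => ?_, fun x => ?_⟩
      · have hd : ∀ y, HasDerivAt (iteratedDeriv j φ) (iteratedDeriv (j + 1) φ y) y := by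
          intro y
          rw [iteratedDeriv_succ]
          exact (φ.contDiff.differentiable_iteratedDeriv j
            (by exact_mod_cast ENat.natCast_lt_top j) y).hasDerivAt
        have := intervalIntegral.integral_eq_sub_of_hasDerivAt (a := 0) (b := x) (fun y _ => hd y)
          ((φ.contDiff.continuous_iteratedDeriv (j + 1)
            (by exact_mod_cast le_top)).intervalIntegrable _ _)
        exact this.symm
      · have := φ.periodic x
        simpa [jetMap] using this
    · rintro ⟨h1, h2⟩
      have hd : ∀ j y, HasDerivAt (g j) (g (j + 1) y) y := by
        intro j y
        have h3 := (intervalIntegral.integral_hasDerivAt_right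
          ((g (j + 1)).continuous.intervalIntegrable 0 y)
          ((g (j + 1)).continuous.stronglyMeasurableAtFilter _ _)
          (g (j + 1)).continuous.continuousAt).const_add (g j 0)
        refine h3.congr_of_eventuallyEq (Eventually.of_forall fun x => ?_)
        simp [← h1 j x]
      have hi : ∀ j, iteratedDeriv j (g 0) = g j := by
        intro j
        induction j with
        | zero => simp
        | succ j ih =>
          rw [iteratedDeriv_succ, ih]
          exact funext fun y => (hd j y).deriv
      have hc : ContDiff ℝ ∞ (g 0) := by
        refine contDiff_of_differentiable_iteratedDeriv fun m _ => ?_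
        rw [hi m]
        exact fun y => (hd m y).differentiableAt
      refine ⟨CircleTest.mk (g 0) hc h2, ?_⟩
      funext j
      ext t
      exact congrFun (hi j) t
  rw [key, Set.ofPred_and, Set.ofPred_forall, Set.ofPred_forall]
  refine IsClosed.inter (isClosed_iInter fun j => ?_) (isClosed_iInter fun x => ?_)
  · rw [Set.ofPred_forall]
    refine isClosed_iInter fun x => isClosed_eq ?_ ?_
    · exact ((continuous_eval_const (F := ℝ →ᵇ ℂ) x).comp (continuous_apply j)).sub
        ((continuous_eval_const (F := ℝ →ᵇ ℂ) 0).comp (continuous_apply j))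
    · have hI : Continuous fun u : ℝ →ᵇ ℂ => ∫ t in (0:ℝ)..x, u t := by
        simpa using continuous_pairing (f := fun _ => 1) (a := 0) (b := x)
          (continuous_const.intervalIntegrable _ _)
      exact hI.comp (continuous_apply (j + 1))
  · exact isClosed_eq ((continuous_eval_const (F := ℝ →ᵇ ℂ) _).comp (continuous_apply 0))
      ((continuous_eval_const (F := ℝ →ᵇ ℂ) x).comp (continuous_apply 0))

instance : CompleteSpace CircleTest :=
  (completeSpace_iff_isComplete_range isUniformInducing_jetMap).2 isClosed_range_jetMap.isComplete

instance : (uniformity CircleTest).IsCountablyGenerated :=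
  Filter.comap.isCountablyGenerated _ _

instance : BarrelledSpace ℂ CircleTest := inferInstance

/-- The space `𝒟'(∂D)` of distributions on the circle. -/
abbrev CircleDistribution : Type := CircleTest →L[ℂ] ℂ

/-- Multiplication of test functions by a fixed smooth function `g` on the circle. -/
def mulTest (g : CircleTest) : CircleTest →L[ℂ] CircleTest where
  toFun φ := CircleTest.mk (fun t => g t * φ t) (g.contDiff.mul φ.contDiff)
    (fun t => by simp only [g.periodic t, φ.periodic t])
  map_add' φ χ := by ext t; exact mul_add _ _ _
  map_smul' a φ := by ext t; exact mul_left_comm _ _ _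
  cont := by
    refine isUniformInducing_jetMap.isInducing.continuous_iff.2 (continuous_pi_iff.2 ?_)
    intro j
    have h : ∀ φ : CircleTest, ∑ i ∈ Finset.range (j + 1),
        (j.choose i : ℂ) • (g.jet i * φ.jet (j - i)) = (CircleTest.mk (fun t => g t * φ t)
          (g.contDiff.mul φ.contDiff) (fun t => by simp only [g.periodic t, φ.periodic t])).jet j := by
      intro φ
      ext t
      exact Eq.trans (by simp [BoundedContinuousFunction.coe_sum, mul_assoc])
        (iteratedDeriv_fun_mul (n := j) (x := t)
        (g.contDiff.contDiffAt.of_le (by exact_mod_cast le_top))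
        (φ.contDiff.contDiffAt.of_le (by exact_mod_cast le_top))).symm
    refine (Continuous.congr ?_ h)
    exact continuous_finsetSum _ fun i _ =>
      Continuous.const_smul (c := (j.choose i : ℂ))
        (Continuous.mul (f := fun _ : CircleTest => g.jet i) continuous_const
          (continuous_jet (j - i)))

/-- Complex conjugation of test functions. -/
def conjTest (φ : CircleTest) : CircleTest :=
  CircleTest.mk (fun t => (starRingEnd ℂ) (φ t)) (Complex.conjCLE.contDiff.comp φ.contDiff)
    (fun t => by simp only [φ.periodic t])

theorem iteratedDeriv_conj (φ : CircleTest) (j : ℕ) (t : ℝ) :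
    iteratedDeriv j (fun t => (starRingEnd ℂ) (φ t)) t = (starRingEnd ℂ) (iteratedDeriv j φ t) := by
  induction j generalizing t with
  | zero => simp
  | succ j ih =>
    rw [iteratedDeriv_succ, iteratedDeriv_succ, funext ih]
    have hd := (φ.contDiff.differentiable_iteratedDeriv j
            (by exact_mod_cast ENat.natCast_lt_top j) t).hasDerivAt
    exact hd.star.deriv

theorem continuous_conjTest : Continuous conjTest := by
  refine isUniformInducing_jetMap.isInducing.continuous_iff.2 (continuous_pi_iff.2 ?_)
  intro j
  have h : ∀ φ : CircleTest, star (φ.jet j) = (conjTest φ).jet j := by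
    intro φ
    ext t
    exact (iteratedDeriv_conj φ j t).symm
  refine Continuous.congr ?_ h
  exact continuous_star.comp (continuous_jet j)

/-- The complex conjugate of a distribution: `⟨ū, φ⟩` is the conjugate of `⟨u, φ̄⟩`. -/
def conjDist (u : CircleDistribution) : CircleDistribution where
  toFun φ := (starRingEnd ℂ) (u (conjTest φ))
  map_add' φ χ := by
    have : conjTest (φ + χ) = conjTest φ + conjTest χ := by ext t; exact map_add (starRingEnd ℂ) (φ t) (χ t)
    simp [this]
  map_smul' a φ := by
    have : conjTest (a • φ) = (starRingEnd ℂ) a • conjTest φ := by ext t; exact map_mul (starRingEnd ℂ) a (φ t)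
    simp [this]
  cont := Complex.continuous_conj.comp (u.continuous.comp continuous_conjTest)

/-- The real part `(u + ū) / 2` of a distribution. -/
def reDist (u : CircleDistribution) : CircleDistribution := (1 / 2 : ℂ) • (u + conjDist u)

/-- The imaginary part `(u - ū) / (2i)` of a distribution. -/
def imDist (u : CircleDistribution) : CircleDistribution :=
  (1 / (2 * Complex.I)) • (u - conjDist u)

/-- The product `g u` of a smooth function and a distribution. -/
def mulDist (g : CircleTest) (u : CircleDistribution) : CircleDistribution := u.comp (mulTest g)

/-- The smooth function `e^{-iℓθ}` on the circle. -/
def expTest (ℓ : ℕ) : CircleTest :=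
  CircleTest.mk (fun t => Complex.exp (-Complex.I * ℓ * t))
    (by
      have h : ContDiff ℝ ∞ (fun t : ℝ => (t : ℂ)) := Complex.ofRealCLM.contDiff
      exact (contDiff_const.mul h).cexp)
    (fun t => by
      refine Complex.exp_eq_exp_iff_exists_int.2 ⟨-ℓ, by push_cast; ring⟩)

/-- The constant function `1` on the circle. -/
def oneTest : CircleTest := CircleTest.mk (fun _ => 1) contDiff_const (fun _ => rfl)

/-- The Poisson kernel `P_r(θ)`. -/
def poisson (r θ : ℝ) : ℝ := (1 - r ^ 2) / (1 - 2 * r * Real.cos θ + r ^ 2)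

/-- The test function `P_r(θ - ·)`, for `0 ≤ r`. -/
def poissonTest (r : ℝ) (hr : 0 ≤ r) (θ : ℝ) : CircleTest :=
  CircleTest.mk (fun t => (poisson r (θ - t) : ℂ))
    (by
      refine Complex.ofRealCLM.contDiff.comp ?_
      by_cases h : r = 1
      · subst h
        have h0 : (fun t => poisson 1 (θ - t)) = fun _ => 0 := by
          funext t
          simp [poisson]
        exact h0 ▸ contDiff_const
      · refine contDiff_const.div (((contDiff_const.sub (contDiff_const.mul
          (Real.contDiff_cos.comp (contDiff_const.sub contDiff_id)))).add contDiff_const)) ?_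
        intro t
        have h1 := Real.cos_le_one (θ - t)
        have h2 : 0 < (1 - r) ^ 2 := by
          have : 1 - r ≠ 0 := sub_ne_zero.2 (Ne.symm h)
          positivity
        change 1 - 2 * r * Real.cos (θ - t) + r ^ 2 ≠ 0
        nlinarith [mul_nonneg hr (sub_nonneg.2 h1)])
    (fun t => by
      have : θ - (t + 2 * Real.pi) = (θ - t) - 2 * Real.pi := by ring
      simp only [poisson, this, Real.cos_sub_two_pi])

/-! ### Boundary values in the sense of distributions -/

/-- The open unit disk `D`. -/
abbrev D : Set ℂ := Metric.ball 0 1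

/-- The integral of `f(re^{iθ}) φ(θ)` over `0 ≤ θ ≤ 2π`. -/
def circlePairing (f : ℂ → ℂ) (r : ℝ) (φ : CircleTest) : ℂ :=
  ∫ θ in (0 : ℝ)..2 * Real.pi, f (r * Complex.exp (Complex.I * θ)) * φ θ

/-- `f` has a boundary value in the sense of distributions: the integrals of `f(re^{iθ}) φ(θ)`
exist and converge as `r ↗ 1`, for every test function `φ`. -/
structure HasBdryValue (f : ℂ → ℂ) : Prop where
  integrable : ∀ r ∈ Ioo (0 : ℝ) 1, IntervalIntegrable
    (fun θ : ℝ => f (r * Complex.exp (Complex.I * θ))) volume 0 (2 * Real.pi)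
  exists_lim : ∀ φ : CircleTest, ∃ L : ℂ,
    Tendsto (fun r => circlePairing f r φ) (𝓝[<] 1) (𝓝 L)

/-- By the uniform boundedness principle the limits form a distribution. -/
theorem HasBdryValue.exists_distribution {f : ℂ → ℂ} (hf : HasBdryValue f) :
    ∃ u : CircleDistribution, ∀ φ,
      Tendsto (fun r => circlePairing f r φ) (𝓝[<] 1) (𝓝 (u φ)) := by
  classical
  choose L hL using hf.exists_lim
  have hi : ∀ r ∈ Ioo (0 : ℝ) 1, ∀ φ : CircleTest, IntervalIntegrable
      (fun θ : ℝ => f (r * Complex.exp (Complex.I * θ)) * φ θ) volume 0 (2 * Real.pi) :=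
    fun r hr φ => (hf.integrable r hr).mul_continuousOn φ.contDiff.continuous.continuousOn
  let g : ℝ → CircleTest →L[ℂ] ℂ := fun r =>
    if hr : r ∈ Ioo (0 : ℝ) 1 then
      { toFun := circlePairing f r
        map_add' := fun φ χ => by
          simp only [circlePairing, CircleTest.add_apply, mul_add]
          exact intervalIntegral.integral_add (hi r hr φ) (hi r hr χ)
        map_smul' := fun a φ => by
          simp only [circlePairing, CircleTest.smul_apply, RingHom.id_apply, smul_eq_mul,
            mul_left_comm _ a]
          exact intervalIntegral.integral_const_mul _ _
        cont := by
          have h := (continuous_pairing (hf.integrable r hr)).comp (continuous_jet 0)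
          exact h.congr fun φ => by simp [circlePairing] }
    else 0
  have hg : ∀ φ, Tendsto (fun r => g r φ) (𝓝[<] 1) (𝓝 (L φ)) := by
    intro φ
    refine (hL φ).congr' ?_
    have : Ioo (0 : ℝ) 1 ∈ 𝓝[<] (1 : ℝ) := Ioo_mem_nhdsLT one_pos
    filter_upwards [this] with r hr
    simp only [g, dif_pos hr]
    rfl
  have hT : Tendsto (fun r φ => g r φ) (𝓝[<] 1) (𝓝 L) := tendsto_pi_nhds.2 hg
  exact ⟨continuousLinearMapOfTendsto g hT, hL⟩

open Classical in
/-- The boundary value `f_b ∈ 𝒟'(∂D)` of a function that has one (and `0` otherwise). -/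
def bdryValue (f : ℂ → ℂ) : CircleDistribution :=
  if hf : HasBdryValue f then hf.exists_distribution.choose else 0

theorem tendsto_bdryValue {f : ℂ → ℂ} (hf : HasBdryValue f) (φ : CircleTest) :
    Tendsto (fun r => circlePairing f r φ) (𝓝[<] 1) (𝓝 (bdryValue f φ)) := by
  rw [bdryValue, dif_pos hf]
  exact hf.exists_distribution.choose_spec φ

/-- The class `H_b` of holomorphic functions on `D` that have boundary values in the sense of
distributions. -/
def MemHb (f : ℂ → ℂ) : Prop := DifferentiableOn ℂ f D ∧ HasBdryValue f

/-! ### Derivatives, Sobolev spaces and the equation -/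

/-- The Cauchy-Riemann operator `∂/∂z̄ = (∂/∂x + i ∂/∂y) / 2` on differentiable functions. -/
def dbar (f : ℂ → ℂ) (z : ℂ) : ℂ :=
  (1 / 2) * (fderiv ℝ f z 1 + Complex.I * fderiv ℝ f z Complex.I)

/-- Smooth functions with compact support in `D`. -/
def IsTestOnDisk (φ : ℂ → ℂ) : Prop :=
  ContDiff ℝ ∞ φ ∧ HasCompactSupport φ ∧ tsupport φ ⊆ D

/-- `g` is the weak derivative of `u` on `D` in the direction `e`. -/
def HasWeakPartial (e : ℂ) (u g : ℂ → ℂ) : Prop :=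
  LocallyIntegrableOn u D ∧ LocallyIntegrableOn g D ∧ ∀ φ, IsTestOnDisk φ →
    ∫ z in D, u z * fderiv ℝ φ z e = -∫ z in D, g z * φ z

/-- `g` is the weak derivative `∂u/∂z̄` of `u` on `D`. -/
def HasWeakDbar (u g : ℂ → ℂ) : Prop :=
  LocallyIntegrableOn u D ∧ LocallyIntegrableOn g D ∧ ∀ φ, IsTestOnDisk φ →
    ∫ z in D, u z * dbar φ z = -∫ z in D, g z * φ z

/-- The Sobolev space `W^{k,q}(D)`: all weak derivatives of order at most `k` are in `L^q(D)`. -/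
def MemSobolev (q : ℝ≥0∞) : ℕ → (ℂ → ℂ) → Prop
  | 0, f => MemLp f q (volume.restrict D)
  | k + 1, f => MemLp f q (volume.restrict D) ∧ ∃ fx fy : ℂ → ℂ,
      HasWeakPartial 1 f fx ∧ HasWeakPartial Complex.I f fy ∧
      MemSobolev q k fx ∧ MemSobolev q k fy

/-- `(∂/∂z̄ - A)^n w = 0` on `D`, the operator `∂/∂z̄ - A` being applied `n` times with weak
derivatives. -/
def SolvesMeta (A : ℂ → ℂ) : ℕ → (ℂ → ℂ) → Prop
  | 0, w => w =ᵐ[volume.restrict D] 0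
  | n + 1, w => ∃ g : ℂ → ℂ, HasWeakDbar w g ∧ SolvesMeta A n (fun z => g z - A z * w z)

/-- `ψ(z) = -(1/π) ∬_D A(ζ) / (ζ - z) dξ dη`. -/
def psi (A : ℂ → ℂ) (z : ℂ) : ℂ := -(1 / Real.pi) * ∫ ζ in D, A ζ / (ζ - z)

/-! ### The explicit solution -/

/-- The terms `i c_{k-1} - I_{k-1} + (1/2π) ⟨(h_{k-1})_b, P_r(θ - ·)⟩` at `z = re^{iθ}`, where
`I_{k-1} = (i/2π) ⟨Im (h_{k-1})_b, 1⟩`. Here `u` stands for `(h_{k-1})_b` and `a` for `c_{k-1}`. -/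
def poissonTerm (u : CircleDistribution) (a : ℝ) (z : ℂ) : ℂ :=
  Complex.I * a - Complex.I / (2 * Real.pi) * imDist u oneTest
    + 1 / (2 * Real.pi) * u (poissonTest ‖z‖ (norm_nonneg z) z.arg)

/-- The poly-analytic expression
`i c_{k-1} - I_{k-1} + (1/2π) ⟨(h_{k-1})_b, P_r(θ - ·)⟩ - ∑_{ℓ=1}^{k-1} (-1)^ℓ/ℓ! z̄^ℓ f_{k-ℓ}(z)`. -/
def schwarzExpr (h : ℕ → ℂ → ℂ) (c : ℕ → ℝ) (f : ℕ → ℂ → ℂ) (k : ℕ) (z : ℂ) : ℂ :=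
  poissonTerm (bdryValue (h (k - 1))) (c (k - 1)) z
    - ∑ ℓ ∈ Finset.Icc 1 (k - 1),
        ((-1) ^ ℓ / (ℓ.factorial : ℂ)) * (starRingEnd ℂ) z ^ ℓ * f (k - ℓ) z

/-- The functions `f_k`: `f_0 = 0`, and `f_k` is given by `schwarzExpr` in terms of
`f_1, …, f_{k-1}` for `k ≥ 1`, see `polyF_eq`; in this definition `ℓ = j + 1`. -/
def polyF (h : ℕ → ℂ → ℂ) (c : ℕ → ℝ) : ℕ → ℂ → ℂ
  | 0 => fun _ => 0
  | k + 1 => fun z => poissonTerm (bdryValue (h k)) (c k) z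
      - ∑ j : Fin k, ((-1) ^ (j.1 + 1) / ((j.1 + 1).factorial : ℂ))
          * (starRingEnd ℂ) z ^ (j.1 + 1) * polyF h c (k - j.1) z
  decreasing_by omega

theorem polyF_zero (h : ℕ → ℂ → ℂ) (c : ℕ → ℝ) : polyF h c 0 = fun _ => 0 := by
  rw [polyF]

theorem polyF_eq (h : ℕ → ℂ → ℂ) (c : ℕ → ℝ) (k : ℕ) (hk : 1 ≤ k) (z : ℂ) :
    polyF h c k z = schwarzExpr h c (polyF h c) k z := by
  obtain ⟨k, rfl⟩ : ∃ m, k = m + 1 := ⟨k - 1, by omega⟩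
  rw [polyF, schwarzExpr]
  simp only [Nat.add_sub_cancel]
  congr 1
  rw [Finset.sum_range (fun j => ((-1) ^ (j + 1) / ((j + 1).factorial : ℂ))
          * (starRingEnd ℂ) z ^ (j + 1) * polyF h c (k - j) z) |>.symm, Finset.range_eq_Ico]
  have e := Finset.sum_Ico_add' (fun ℓ => ((-1) ^ ℓ / (ℓ.factorial : ℂ)) * (starRingEnd ℂ) z ^ ℓ
      * polyF h c (k + 1 - ℓ) z) 0 k 1
  simp only [Nat.add_sub_add_right] at e
  exact e

/-- The distribution
`(h_{k-1})_b - ∑_{ℓ=1}^{k-1} (-1)^ℓ/ℓ! e^{-iℓ(·)} (f_{k-ℓ})_b` in the boundary conditions. -/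
def bdryData (h f : ℕ → ℂ → ℂ) (k : ℕ) : CircleDistribution :=
  bdryValue (h (k - 1)) - ∑ ℓ ∈ Finset.Icc 1 (k - 1),
    ((-1) ^ ℓ / (ℓ.factorial : ℂ)) • mulDist (expTest ℓ) (bdryValue (f (k - ℓ)))

/-- The function
`w = e^ψ [i c_{n-1} - I_{n-1} + (1/2π) ⟨(h_{n-1})_b, P_r(θ - ·)⟩ - ∑ (-1)^ℓ/ℓ! z̄^ℓ f_{n-ℓ}(z)]`. -/
def metaW (A : ℂ → ℂ) (h : ℕ → ℂ → ℂ) (c : ℕ → ℝ) (n : ℕ) (z : ℂ) : ℂ :=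
  Complex.exp (psi A z) * schwarzExpr h c (polyF h c) n z

end SchwarzMeta

end

noncomputable section

namespace SchwarzMeta

/-! ### Boundary values -/

/-! For `h` in `H_b`, the Poisson formula for the dilates `h(r·)` and the limit `r → 1` show that
pairing `h_b` with the Poisson kernel returns `h`. Hence the non-recursive part of `f_k` is
`h_{k-1}` plus the imaginary constant `i(c_{k-1} - Im h_{k-1}(0))` on the disk (`poissonTerm_eq`,
`polyF_eqOn`). All claims about `f_k` follow from this form: the `∂/∂z̄` derivatives of the terms
`z̄^ℓ f_{k-ℓ}` telescope and leave `f_{k-1}` (`dbar_polyF`); on the boundary `z̄^ℓ` becomes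
`e^{-iℓθ}`, and the boundary value differs from the prescribed data only by an imaginary constant
(`isBdryValue_polyF`); at `0` every term with `ℓ ≥ 1` vanishes.

Since `w / e^ψ` is `f_n`, its iterated derivatives are the `f_{n-k}`. For the equation the key is
`∂(e^ψ)/∂z̄ = A e^ψ` in the weak sense (`exp_psi_weak`). For smooth compactly supported `B`, the
Cauchy-Pompeiu formula gives `∂v/∂z̄ = B` for its Cauchy transform `v` (`dbar_cauchyTransform`), and
the classical chain rule applies to `e^v`. The general case is a limit: `1/ζ` is locally in `L^b`
for `b < 2`, so by Hölder convergence `B_j → A` in `L^a` with `a > 2` makes the transforms converge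
uniformly on the disk (`exists_cauchy_bound`, `exists_approx_psi`). The product rule then gives
`(∂/∂z̄ - A)(e^ψ f_k) = e^ψ f_{k-1}`, a chain that ends at `f_0 = 0`. -/

/-- The distribution `u` is the boundary value of `f`. -/
structure IsBdryValue (f : ℂ → ℂ) (u : CircleDistribution) : Prop where
  integrable : ∀ r ∈ Ioo (0 : ℝ) 1, IntervalIntegrable
    (fun θ : ℝ => f (r * Complex.exp (Complex.I * θ))) volume 0 (2 * Real.pi)
  tendsto : ∀ φ : CircleTest, Tendsto (fun r => circlePairing f r φ) (𝓝[<] 1) (𝓝 (u φ))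

theorem IsBdryValue.hasBdryValue {f : ℂ → ℂ} {u : CircleDistribution} (h : IsBdryValue f u) :
    HasBdryValue f := ⟨h.integrable, fun φ => ⟨_, h.tendsto φ⟩⟩

theorem HasBdryValue.isBdryValue {f : ℂ → ℂ} (h : HasBdryValue f) :
    IsBdryValue f (bdryValue f) := ⟨h.integrable, tendsto_bdryValue h⟩

theorem IsBdryValue.bdryValue_eq {f : ℂ → ℂ} {u : CircleDistribution} (h : IsBdryValue f u) :
    bdryValue f = u :=
  ContinuousLinearMap.ext fun φ =>
    tendsto_nhds_unique (tendsto_bdryValue h.hasBdryValue φ) (h.tendsto φ)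

theorem eventually_mem_Ioo_nhdsLT_one : ∀ᶠ r : ℝ in 𝓝[<] 1, r ∈ Ioo (0 : ℝ) 1 :=
  Ioo_mem_nhdsLT one_pos

theorem circle_point_mem_D {r : ℝ} (hr : r ∈ Ioo (0 : ℝ) 1) (θ : ℝ) :
    (r : ℂ) * Complex.exp (Complex.I * θ) ∈ D := by
  rw [mem_ball_zero_iff, norm_mul, mul_comm Complex.I, Complex.norm_exp_ofReal_mul_I, mul_one,
    Complex.norm_real, Real.norm_of_nonneg hr.1.le]
  exact hr.2

theorem IsBdryValue.congr {f g : ℂ → ℂ} {u : CircleDistribution} (h : IsBdryValue f u)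
    (hfg : EqOn f g D) : IsBdryValue g u where
  integrable r hr := by
    have := h.integrable r hr
    simpa only [hfg (circle_point_mem_D hr _)] using this
  tendsto φ := by
    refine (h.tendsto φ).congr' ?_
    filter_upwards [eventually_mem_Ioo_nhdsLT_one] with r hr
    simp only [circlePairing, hfg (circle_point_mem_D hr _)]

theorem intervalIntegrable_mul_test {f : ℝ → ℂ} {a b : ℝ} (hf : IntervalIntegrable f volume a b)
    (φ : CircleTest) : IntervalIntegrable (fun θ => f θ * φ θ) volume a b :=
  hf.mul_continuousOn φ.contDiff.continuous.continuousOn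

theorem IsBdryValue.add {f g : ℂ → ℂ} {u v : CircleDistribution} (hf : IsBdryValue f u)
    (hg : IsBdryValue g v) : IsBdryValue (fun z => f z + g z) (u + v) where
  integrable r hr := (hf.integrable r hr).add (hg.integrable r hr)
  tendsto φ := by
    refine ((hf.tendsto φ).add (hg.tendsto φ)).congr' ?_
    filter_upwards [eventually_mem_Ioo_nhdsLT_one] with r hr
    simp only [circlePairing, add_mul]
    exact (intervalIntegral.integral_add (intervalIntegrable_mul_test (hf.integrable r hr) φ)
      (intervalIntegrable_mul_test (hg.integrable r hr) φ)).symm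

theorem IsBdryValue.const_mul {f : ℂ → ℂ} {u : CircleDistribution} (hf : IsBdryValue f u)
    (a : ℂ) : IsBdryValue (fun z => a * f z) (a • u) where
  integrable r hr := (hf.integrable r hr).const_mul a
  tendsto φ := by
    refine ((hf.tendsto φ).const_mul a).congr fun r => ?_
    simp only [circlePairing, mul_assoc]
    exact (intervalIntegral.integral_const_mul _ _).symm

theorem IsBdryValue.sub {f g : ℂ → ℂ} {u v : CircleDistribution} (hf : IsBdryValue f u)
    (hg : IsBdryValue g v) : IsBdryValue (fun z => f z - g z) (u - v) := by
  have h := hf.add (hg.const_mul (-1))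
  have e : u + (-1 : ℂ) • v = u - v := by
    ext φ
    simp only [add_apply, smul_apply, sub_apply, smul_eq_mul]
    ring
  rw [e] at h
  exact h.congr fun z _ => by ring

theorem hasBdryValue_const (a : ℂ) : HasBdryValue fun _ => a :=
  ⟨fun _ _ => intervalIntegrable_const, fun _ => ⟨_, tendsto_const_nhds⟩⟩

theorem bdryValue_const_apply (a : ℂ) (φ : CircleTest) :
    bdryValue (fun _ => a) φ = a * ∫ θ in (0 : ℝ)..2 * Real.pi, φ θ := by
  refine tendsto_nhds_unique (tendsto_bdryValue (hasBdryValue_const a) φ) ?_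
  simp only [circlePairing, intervalIntegral.integral_const_mul]
  exact tendsto_const_nhds

theorem IsBdryValue.sum {ι : Type*} {s : Finset ι} {f : ι → ℂ → ℂ} {u : ι → CircleDistribution}
    (h : ∀ i ∈ s, IsBdryValue (f i) (u i)) :
    IsBdryValue (fun z => ∑ i ∈ s, f i z) (∑ i ∈ s, u i) := by
  classical
  induction s using Finset.induction_on with
  | empty =>
    simp only [Finset.sum_empty]
    have h0 := (hasBdryValue_const 0).isBdryValue
    have : bdryValue (fun _ => (0 : ℂ)) = 0 := by
      ext φ
      simp [bdryValue_const_apply]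
    rwa [this] at h0
  | insert i s hi ih =>
    simp only [Finset.sum_insert hi]
    exact (h i (Finset.mem_insert_self i s)).add
      (ih fun j hj => h j (Finset.mem_insert_of_mem hj))

theorem conj_pow_circle_point (ℓ : ℕ) (r θ : ℝ) :
    (starRingEnd ℂ) (r * Complex.exp (Complex.I * θ)) ^ ℓ = (r : ℂ) ^ ℓ * expTest ℓ θ := by
  have : expTest ℓ θ = Complex.exp (-Complex.I * ℓ * θ) := rfl
  rw [this, map_mul, mul_pow, Complex.conj_ofReal, ← Complex.exp_conj, ← Complex.exp_nat_mul,
    map_mul, Complex.conj_I, Complex.conj_ofReal]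
  ring_nf

/-- On the circle of radius `r`, `z̄^ℓ` equals `r^ℓ e^{-iℓθ}`: the exponential is absorbed into the
test function and `r^ℓ → 1`. -/
theorem IsBdryValue.conj_pow_mul {f : ℂ → ℂ} {u : CircleDistribution} (hf : IsBdryValue f u)
    (ℓ : ℕ) : IsBdryValue (fun z => (starRingEnd ℂ) z ^ ℓ * f z) (mulDist (expTest ℓ) u) where
  integrable r hr := by
    refine (hf.integrable r hr).continuousOn_mul (Continuous.continuousOn ?_)
    fun_prop
  tendsto φ := by
    have h1 : Tendsto (fun r : ℝ => (r : ℂ) ^ ℓ) (𝓝[<] 1) (𝓝 1) := by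
      have : Continuous fun r : ℝ => (r : ℂ) ^ ℓ := by fun_prop
      simpa using (this.tendsto 1).mono_left nhdsWithin_le_nhds
    have h2 := h1.mul (hf.tendsto (mulTest (expTest ℓ) φ))
    rw [one_mul] at h2
    refine h2.congr fun r => ?_
    simp only [circlePairing, conj_pow_circle_point]
    rw [← intervalIntegral.integral_const_mul]
    refine intervalIntegral.integral_congr fun θ _ => ?_
    have : mulTest (expTest ℓ) φ θ = expTest ℓ θ * φ θ := rfl
    simp only [this]
    ring

/-! ### Real parts -/

theorem reDist_apply (u : CircleDistribution) (φ : CircleTest) :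
    reDist u φ = 1 / 2 * (u φ + (starRingEnd ℂ) (u (conjTest φ))) := rfl

theorem imDist_apply (u : CircleDistribution) (φ : CircleTest) :
    imDist u φ = 1 / (2 * Complex.I) * (u φ - (starRingEnd ℂ) (u (conjTest φ))) := rfl

theorem reDist_add (u v : CircleDistribution) : reDist (u + v) = reDist u + reDist v := by
  ext φ
  simp only [reDist_apply, add_apply, map_add]
  ring

/-- This removes the only discrepancy between the boundary value of `f_k` and the prescribed data.
-/
theorem reDist_bdryValue_imaginary (a : ℝ) : reDist (bdryValue fun _ => Complex.I * a) = 0 := by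
  ext φ
  have : ∫ θ in (0 : ℝ)..2 * Real.pi, conjTest φ θ
      = (starRingEnd ℂ) (∫ θ in (0 : ℝ)..2 * Real.pi, φ θ) := by
      rw [intervalIntegral.integral_of_le Real.two_pi_pos.le,
        intervalIntegral.integral_of_le Real.two_pi_pos.le]
      exact integral_conj
  rw [reDist_apply, bdryValue_const_apply, bdryValue_const_apply, this]
  simp

/-! ### The Poisson formula -/

/-- The dilate `ζ ↦ f(rζ)` is holomorphic up to the closed disk, so the classical Poisson formula
applies to it. The factor `2π` converts the circle average into an integral. -/
theorem circlePairing_poissonTest {f : ℂ → ℂ} (hf : DifferentiableOn ℂ f D) {z : ℂ} (hz : z ∈ D)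
    {r : ℝ} (hr : r ∈ Ioo (0 : ℝ) 1) :
    circlePairing f r (poissonTest ‖z‖ (norm_nonneg z) z.arg) = 2 * Real.pi * f (r * z) := by
  have hd : DiffContOnCl ℂ (fun ζ => f (r * ζ)) (Metric.ball 0 1) := by
    refine DifferentiableOn.diffContOnCl_ball (U := Metric.closedBall 0 1) ?_ subset_rfl
    refine hf.comp (by fun_prop) fun ζ hζ => ?_
    rw [mem_closedBall_zero_iff] at hζ
    rw [mem_ball_zero_iff, norm_mul, Complex.norm_real, Real.norm_of_nonneg hr.1.le]
    nlinarith [hr.1, hr.2]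
  have h := hd.circleAverage_poissonKernel_smul' hz
  rw [Real.circleAverage_def] at h
  have hpi : (Real.pi : ℂ) ≠ 0 := by exact_mod_cast Real.pi_ne_zero
  have h2 : circlePairing f r (poissonTest ‖z‖ (norm_nonneg z) z.arg)
      = ∫ θ in (0 : ℝ)..2 * Real.pi, (fun ζ => ((‖ζ - 0‖ ^ 2 - ‖z - 0‖ ^ 2) /
        ‖(ζ - 0) - (z - 0)‖ ^ 2) • f (r * ζ)) (circleMap 0 1 θ) := by
    refine intervalIntegral.integral_congr fun θ _ => ?_
    have hp : poissonTest ‖z‖ (norm_nonneg z) z.arg θ = (poisson ‖z‖ (z.arg - θ) : ℂ) := rfl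
    -- By the law of cosines the denominator of `P_r` is `|e^{iθ} - z|²`.
    have hk : poisson ‖z‖ (z.arg - θ) = (‖circleMap 0 1 θ - 0‖ ^ 2 - ‖z - 0‖ ^ 2) /
        ‖(circleMap 0 1 θ - 0) - (z - 0)‖ ^ 2 := by
      have hn : ‖circleMap 0 1 θ‖ = 1 := by simp
      have hre : ‖circleMap 0 1 θ - z‖ ^ 2 = 1 - 2 * ‖z‖ * Real.cos (z.arg - θ) + ‖z‖ ^ 2 := by
        have hc : circleMap 0 1 θ = Complex.mk (Real.cos θ) (Real.sin θ) := by
          apply Complex.ext <;> simp [circleMap, Complex.exp_ofReal_mul_I_re,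
            Complex.exp_ofReal_mul_I_im]
        rw [Real.cos_sub, ← Complex.normSq_eq_norm_sq, Complex.normSq_apply, hc]
        have h1 := Complex.norm_mul_cos_arg z
        have h2 := Complex.norm_mul_sin_arg z
        have h3 : ‖z‖ ^ 2 = z.re * z.re + z.im * z.im := by
          rw [← Complex.normSq_eq_norm_sq, Complex.normSq_apply]
        simp only [Complex.sub_re, Complex.sub_im]
        rw [h3]
        linear_combination Real.cos_sq_add_sin_sq θ + 2 * Real.cos θ * h1 + 2 * Real.sin θ * h2
      simp only [sub_zero, hn, hre, poisson, one_pow]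
    have hc : circleMap 0 1 θ = Complex.exp (Complex.I * θ) := by
      simp [circleMap, mul_comm]
    simp only [hp, hk]
    rw [hc, Complex.real_smul, mul_comm]
  rw [h2]
  rw [Complex.real_smul] at h
  rw [← h]
  push_cast
  rw [← mul_assoc, mul_inv_cancel₀ (mul_ne_zero two_ne_zero hpi), one_mul]

theorem bdryValue_poissonTest {f : ℂ → ℂ} (hf : MemHb f) {z : ℂ} (hz : z ∈ D) :
    bdryValue f (poissonTest ‖z‖ (norm_nonneg z) z.arg) = 2 * Real.pi * f z := by
  refine tendsto_nhds_unique (tendsto_bdryValue hf.2 _) ?_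
  have hc : ContinuousAt f z := (hf.1.differentiableAt (Metric.isOpen_ball.mem_nhds hz)).continuousAt
  have h1 : Tendsto (fun r : ℝ => (r : ℂ) * z) (𝓝[<] 1) (𝓝 z) := by
    have : Continuous fun r : ℝ => (r : ℂ) * z := by fun_prop
    simpa using (this.tendsto 1).mono_left nhdsWithin_le_nhds
  refine Tendsto.congr' ?_ ((hc.tendsto.comp h1).const_mul (2 * Real.pi : ℂ))
  filter_upwards [eventually_mem_Ioo_nhdsLT_one] with r hr
  exact (circlePairing_poissonTest hf.1 hz hr).symm

theorem zero_mem_D : (0 : ℂ) ∈ D := Metric.mem_ball_self one_pos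

/-- The Poisson kernel of the centre is the constant `1`, whatever the value of `arg 0`. -/
theorem bdryValue_oneTest {f : ℂ → ℂ} (hf : MemHb f) :
    bdryValue f oneTest = 2 * Real.pi * f 0 := by
  rw [← bdryValue_poissonTest hf zero_mem_D]
  congr 1
  ext t
  change (1 : ℂ) = (poisson ‖(0 : ℂ)‖ _ : ℂ)
  simp [poisson]

/-- The pairing with the Poisson kernel reproduces `f`, and `⟨Im f_b, 1⟩ = 2π Im f(0)`, so
subtracting `I` replaces the imaginary part at `0` by `a`. -/
theorem poissonTerm_eq {f : ℂ → ℂ} (hf : MemHb f) (a : ℝ) {z : ℂ} (hz : z ∈ D) :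
    poissonTerm (bdryValue f) a z = f z + Complex.I * ((a - (f 0).im : ℝ) : ℂ) := by
  have hpi : (Real.pi : ℂ) ≠ 0 := by exact_mod_cast Real.pi_ne_zero
  have hconj : conjTest oneTest = oneTest := by
    ext t
    exact map_one (starRingEnd ℂ)
  have him : imDist (bdryValue f) oneTest = 2 * Real.pi * (f 0).im := by
    have h := Complex.sub_conj (f 0)
    rw [imDist_apply, hconj, bdryValue_oneTest hf]
    simp only [map_mul, Complex.conj_ofReal, Complex.conj_ofNat]
    rw [← mul_sub, h]
    field_simp
    push_cast
    ring
  rw [poissonTerm, him, bdryValue_poissonTest hf hz]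
  push_cast
  field_simp
  ring

/-! ### The Cauchy-Riemann operator -/

theorem dbar_congr {f g : ℂ → ℂ} {z : ℂ} (h : f =ᶠ[𝓝 z] g) : dbar f z = dbar g z := by
  simp only [dbar, h.fderiv_eq]

theorem dbar_add {f g : ℂ → ℂ} {z : ℂ} (hf : DifferentiableAt ℝ f z)
    (hg : DifferentiableAt ℝ g z) : dbar (fun z => f z + g z) z = dbar f z + dbar g z := by
  simp only [dbar, fderiv_fun_add hf hg, add_apply]
  ring

theorem dbar_sub {f g : ℂ → ℂ} {z : ℂ} (hf : DifferentiableAt ℝ f z)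
    (hg : DifferentiableAt ℝ g z) : dbar (fun z => f z - g z) z = dbar f z - dbar g z := by
  simp only [dbar, fderiv_fun_sub hf hg, sub_apply]
  ring

theorem dbar_const (a z : ℂ) : dbar (fun _ => a) z = 0 := by
  simp [dbar]

theorem dbar_sum {ι : Type*} {s : Finset ι} {f : ι → ℂ → ℂ} {z : ℂ}
    (h : ∀ i ∈ s, DifferentiableAt ℝ (f i) z) :
    dbar (fun z => ∑ i ∈ s, f i z) z = ∑ i ∈ s, dbar (f i) z := by
  simp only [dbar, fderiv_fun_sum h, sum_apply, Finset.mul_sum, mul_add,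
    Finset.sum_add_distrib]

theorem dbar_mul {f g : ℂ → ℂ} {z : ℂ} (hf : DifferentiableAt ℝ f z)
    (hg : DifferentiableAt ℝ g z) :
    dbar (fun z => f z * g z) z = f z * dbar g z + dbar f z * g z := by
  simp only [dbar, fderiv_fun_mul hf hg, add_apply, smul_apply, smul_eq_mul]
  ring

/-- Complex linearity of the derivative sends `i` to `i` times the image of `1`, and `1 + i·i = 0`.
-/
theorem dbar_eq_zero {f : ℂ → ℂ} {z : ℂ} (hf : DifferentiableAt ℂ f z) : dbar f z = 0 := by
  have h : fderiv ℂ f z Complex.I = Complex.I * fderiv ℂ f z 1 := by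
    simpa only [smul_eq_mul, mul_one] using (fderiv ℂ f z).map_smul Complex.I 1
  rw [dbar, hf.fderiv_restrictScalars ℝ]
  simp only [ContinuousLinearMap.coe_restrictScalars', h, ← mul_assoc, Complex.I_mul_I]
  ring

theorem dbar_comp {f g : ℂ → ℂ} {z : ℂ} (hg : DifferentiableAt ℂ g (f z))
    (hf : DifferentiableAt ℝ f z) :
    dbar (fun z => g (f z)) z = deriv g (f z) * dbar f z := by
  have h : HasFDerivAt (fun z => g (f z))
      (((fderiv ℂ g (f z)).restrictScalars ℝ).comp (fderiv ℝ f z)) z :=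
    (hg.hasFDerivAt.restrictScalars ℝ).comp z hf.hasFDerivAt
  have h2 : ∀ v, fderiv ℂ g (f z) v = v * deriv g (f z) := fun v => by
    rw [← smul_eq_mul, ← fderiv_apply_one_eq_deriv, ← map_smul, smul_eq_mul, mul_one]
  simp only [dbar, h.fderiv, ContinuousLinearMap.comp_apply,
    ContinuousLinearMap.coe_restrictScalars', h2]
  ring

theorem contDiff_conj {n : WithTop ℕ∞} : ContDiff ℝ n fun z : ℂ => (starRingEnd ℂ) z :=
  Complex.conjCLE.contDiff

theorem differentiable_conj_pow (ℓ : ℕ) :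
    Differentiable ℝ fun z : ℂ => (starRingEnd ℂ) z ^ ℓ :=
  (contDiff_conj.pow ℓ).differentiable one_ne_zero

theorem dbar_conj (z : ℂ) : dbar (fun z => (starRingEnd ℂ) z) z = 1 := by
  have h : fderiv ℝ (fun z => (starRingEnd ℂ) z) z = (Complex.conjCLE : ℂ →L[ℝ] ℂ) :=
    Complex.conjCLE.hasFDerivAt.fderiv
  simp only [dbar, h]
  norm_num

theorem dbar_conj_pow_succ (ℓ : ℕ) (z : ℂ) :
    dbar (fun z => (starRingEnd ℂ) z ^ (ℓ + 1)) z = (ℓ + 1) * (starRingEnd ℂ) z ^ ℓ := by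
  induction ℓ with
  | zero => simp [dbar_conj]
  | succ ℓ ih =>
    have h := dbar_mul (differentiable_conj_pow (ℓ + 1) z) (differentiable_conj_pow 1 z)
    simp only [pow_one, dbar_conj, ih, ← pow_succ] at h
    rw [h]
    push_cast
    ring

/-! ### The functions `f_k` -/

section PolyF

variable {n : ℕ} {h : ℕ → ℂ → ℂ} (hh : ∀ k, k < n → MemHb (h k)) (c : ℕ → ℝ)
include hh

/-- The working form of the recursion: no distribution is left in it, so it can be differentiated
and restricted to circles directly. -/
theorem polyF_eqOn {k : ℕ} (hk : 1 ≤ k) (hkn : k ≤ n) :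
    EqOn (polyF h c k) (fun z => (h (k - 1) z
      + Complex.I * ((c (k - 1) - (h (k - 1) 0).im : ℝ) : ℂ))
      - ∑ ℓ ∈ Finset.Icc 1 (k - 1), ((-1) ^ ℓ / (ℓ.factorial : ℂ)) *
        ((starRingEnd ℂ) z ^ ℓ * polyF h c (k - ℓ) z)) D := by
  intro z hz
  simp only [polyF_eq h c k hk z, schwarzExpr, poissonTerm_eq (hh (k - 1) (by omega)) _ hz,
    mul_assoc]

theorem contDiffOn_polyF {k : ℕ} (hkn : k ≤ n) : ContDiffOn ℝ ∞ (polyF h c k) D := by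
  induction k using Nat.strong_induction_on with
  | _ k ih =>
    rcases Nat.eq_zero_or_pos k with rfl | hk
    · rw [polyF_zero]
      exact contDiffOn_const
    · refine ContDiffOn.congr ?_ (polyF_eqOn hh c hk hkn)
      have h1 : ContDiffOn ℝ ∞ (h (k - 1)) D :=
        ((hh (k - 1) (by omega)).1.contDiffOn Metric.isOpen_ball).restrict_scalars ℝ
      refine (h1.add contDiffOn_const).sub (ContDiffOn.sum fun ℓ hℓ => ?_)
      rw [Finset.mem_Icc] at hℓ
      exact contDiffOn_const.mul ((contDiff_conj.pow ℓ).contDiffOn.mul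
        (ih (k - ℓ) (by omega) (by omega)))

theorem differentiableAt_polyF {k : ℕ} (hkn : k ≤ n) {z : ℂ} (hz : z ∈ D) :
    DifferentiableAt ℝ (polyF h c k) z :=
  ((contDiffOn_polyF hh c hkn).contDiffAt (Metric.isOpen_ball.mem_nhds hz)).differentiableAt
    (by simp)

theorem dbar_polyF {k : ℕ} (hk : 1 ≤ k) (hkn : k ≤ n) {z : ℂ} (hz : z ∈ D) :
    dbar (polyF h c k) z = polyF h c (k - 1) z := by
  induction k using Nat.strong_induction_on with
  | _ k ih =>
    obtain ⟨k, rfl⟩ : ∃ m, k = m + 1 := ⟨k - 1, by omega⟩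
    have hD : D ∈ 𝓝 z := Metric.isOpen_ball.mem_nhds hz
    have hd : DifferentiableAt ℂ (h k) z := (hh k (by omega)).1.differentiableAt hD
    have hdF : ∀ ℓ, 1 ≤ ℓ → DifferentiableAt ℝ (polyF h c (k + 1 - ℓ)) z := fun ℓ hℓ =>
      differentiableAt_polyF hh c (by omega) hz
    have hterm : ∀ ℓ ∈ Finset.Icc 1 k, DifferentiableAt ℝ (fun z => ((-1) ^ ℓ / (ℓ.factorial : ℂ)) *
        ((starRingEnd ℂ) z ^ ℓ * polyF h c (k + 1 - ℓ) z)) z := fun ℓ hℓ =>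
      ((differentiable_conj_pow ℓ z).mul (hdF ℓ (Finset.mem_Icc.1 hℓ).1)).const_mul _
    rw [dbar_congr ((polyF_eqOn hh c hk hkn).eventuallyEq_of_mem hD)]
    simp only [Nat.add_sub_cancel]
    rw [dbar_sub ((hd.restrictScalars ℝ).add_const _) (DifferentiableAt.fun_sum hterm),
      dbar_add (hd.restrictScalars ℝ) (differentiableAt_const _), dbar_eq_zero hd, dbar_const,
      dbar_sum hterm]
    -- `T ℓ` is the part of the `ℓ`-th derivative in which `∂/∂z̄` falls on `f_{k+1-ℓ}`. The part in
    -- which it falls on `z̄^ℓ` is `-T (ℓ-1)`, because `ℓ/ℓ! = 1/(ℓ-1)!` and the sign alternates.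
    set T : ℕ → ℂ := fun ℓ => ((-1) ^ ℓ / (ℓ.factorial : ℂ)) *
      ((starRingEnd ℂ) z ^ ℓ * polyF h c (k - ℓ) z) with hT
    have hstep : ∀ ℓ ∈ Finset.Icc 1 k, dbar (fun z => ((-1) ^ ℓ / (ℓ.factorial : ℂ)) *
        ((starRingEnd ℂ) z ^ ℓ * polyF h c (k + 1 - ℓ) z)) z = T ℓ - T (ℓ - 1) := by
      intro ℓ hℓ
      rw [Finset.mem_Icc] at hℓ
      obtain ⟨m, rfl⟩ : ∃ m, ℓ = m + 1 := ⟨ℓ - 1, by omega⟩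
      have hd' := hdF (m + 1) (by omega)
      rw [dbar_mul (differentiableAt_const _) ((differentiable_conj_pow (m + 1) z).fun_mul hd'),
        dbar_const, dbar_mul (differentiable_conj_pow (m + 1) z) hd', dbar_conj_pow_succ,
        ih (k + 1 - (m + 1)) (by omega) (by omega) (by omega), hT]
      have e1 : k - m - 1 = k - (m + 1) := by omega
      have e2 : k + 1 - (m + 1) = k - m := by omega
      simp only [e2, e1, Nat.add_sub_cancel, Nat.factorial_succ, pow_succ]
      have h1 : (m.factorial : ℂ) ≠ 0 := by exact_mod_cast m.factorial_ne_zero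
      have h2 : (m + 1 : ℂ) ≠ 0 := by exact_mod_cast m.succ_ne_zero
      push_cast
      field_simp
      ring
    have htel : ∀ m, ∑ ℓ ∈ Finset.Icc 1 m, (T ℓ - T (ℓ - 1)) = T m - T 0 := by
      intro m
      induction m with
      | zero => simp
      | succ m ihm =>
        rw [Finset.sum_Icc_succ_top (by omega), ihm, Nat.add_sub_cancel]
        ring
    rw [Finset.sum_congr rfl hstep, htel]
    -- In the telescoped sum `T k` contains `f_0 = 0`, while `T 0 = f_k` survives with the right
    -- sign.
    simp [hT, polyF_zero]

theorem isBdryValue_polyF {k : ℕ} (hk : 1 ≤ k) (hkn : k ≤ n) :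
    IsBdryValue (polyF h c k)
      (bdryData h (polyF h c) k
        + bdryValue fun _ => Complex.I * ((c (k - 1) - (h (k - 1) 0).im : ℝ) : ℂ)) := by
  induction k using Nat.strong_induction_on with
  | _ k ih =>
    refine IsBdryValue.congr ?_ (polyF_eqOn hh c hk hkn).symm
    have e : ∀ ℓ ∈ Finset.Icc 1 (k - 1), IsBdryValue (fun z => ((-1) ^ ℓ / (ℓ.factorial : ℂ)) *
        ((starRingEnd ℂ) z ^ ℓ * polyF h c (k - ℓ) z))
        (((-1) ^ ℓ / (ℓ.factorial : ℂ)) •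
          mulDist (expTest ℓ) (bdryValue (polyF h c (k - ℓ)))) := by
      intro ℓ hℓ
      rw [Finset.mem_Icc] at hℓ
      exact ((ih (k - ℓ) (by omega) (by omega) (by omega)).hasBdryValue.isBdryValue.conj_pow_mul
        ℓ).const_mul _
    have := (((hh (k - 1) (by omega)).2.isBdryValue).add (hasBdryValue_const
      (Complex.I * ((c (k - 1) - (h (k - 1) 0).im : ℝ) : ℂ))).isBdryValue).sub (IsBdryValue.sum e)
    rw [bdryData, sub_add_eq_add_sub]
    exact this

theorem reDist_bdryValue_polyF {k : ℕ} (hk : 1 ≤ k) (hkn : k ≤ n) :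
    reDist (bdryValue (polyF h c k)) = reDist (bdryData h (polyF h c) k) := by
  rw [(isBdryValue_polyF hh c hk hkn).bdryValue_eq, reDist_add, reDist_bdryValue_imaginary,
    add_zero]

theorem im_polyF_zero {k : ℕ} (hk : 1 ≤ k) (hkn : k ≤ n) : (polyF h c k 0).im = c (k - 1) := by
  rw [polyF_eqOn hh c hk hkn zero_mem_D]
  have : ∑ ℓ ∈ Finset.Icc 1 (k - 1), ((-1) ^ ℓ / (ℓ.factorial : ℂ)) *
        ((starRingEnd ℂ) 0 ^ ℓ * polyF h c (k - ℓ) 0) = 0 := by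
    refine Finset.sum_eq_zero fun ℓ hℓ => ?_
    have : ℓ ≠ 0 := by
      rw [Finset.mem_Icc] at hℓ
      omega
    simp [this]
  simp only [this, sub_zero, Complex.add_im, Complex.I_mul_im, Complex.ofReal_re]
  ring

/-- Equality on the open disk is passed on by `∂/∂z̄`, and each application lowers the index by one.
-/
theorem iterate_dbar_polyF {k : ℕ} (hk : k < n) {F : ℂ → ℂ} (hF : EqOn F (polyF h c n) D) :
    EqOn (dbar^[k] F) (polyF h c (n - k)) D := by
  induction k with
  | zero => simpa using hF
  | succ k ih =>
    intro z hz
    rw [Function.iterate_succ_apply',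
      dbar_congr ((ih (by omega)).eventuallyEq_of_mem (Metric.isOpen_ball.mem_nhds hz)),
      dbar_polyF hh c (by omega) (by omega) hz]
    congr 1

end PolyF

/-! ### The Cauchy-Pompeiu formula -/

theorem integrableOn_of_continuous_of_eq_zero {a : ℝ × ℝ → ℂ} (ha : Continuous a) {R : ℝ}
    (h0 : ∀ p : ℝ × ℝ, R < p.1 → a p = 0) :
    IntegrableOn a (Ioi 0 ×ˢ Ioo (-Real.pi) Real.pi) := by
  have hK : IntegrableOn a (Icc 0 R ×ˢ Icc (-Real.pi) Real.pi) :=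
    ha.continuousOn.integrableOn_compact (isCompact_Icc.prod isCompact_Icc)
  refine hK.of_forall_sdiff_eq_zero (measurableSet_Ioi.prod measurableSet_Ioo) ?_
  rintro p ⟨⟨hp1, hp2⟩, hp3⟩
  refine h0 p (lt_of_not_ge fun hle => hp3 ⟨⟨le_of_lt hp1, hle⟩, Ioo_subset_Icc_self hp2⟩)

/-- Fundamental theorem of calculus along a ray; the ray embeds isometrically, so `φ` keeps compact
support on it. -/
theorem integral_radial_deriv {φ : ℂ → ℂ} (hφ : ContDiff ℝ ∞ φ) (hc : HasCompactSupport φ)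
    {e : ℂ} (he : ‖e‖ = 1) : ∫ r in Ioi (0 : ℝ), fderiv ℝ φ (r * e) e = -φ 0 := by
  have hiso : Isometry fun r : ℝ => (r : ℂ) * e := by
    refine Isometry.of_dist_eq fun x y => ?_
    rw [dist_eq_norm, ← sub_mul, norm_mul, he, mul_one, ← Complex.ofReal_sub, Complex.norm_real,
      dist_eq_norm]
  have hd : ∀ r : ℝ, HasDerivAt (fun r : ℝ => φ (r * e)) (fderiv ℝ φ (r * e) e) r := by
    intro r
    have h1 : HasDerivAt (fun r : ℝ => (r : ℂ) * e) e r := by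
      simpa using (Complex.ofRealCLM.hasDerivAt (x := r)).mul_const e
    exact ((hφ.differentiable (by simp)).differentiableAt.hasFDerivAt).comp_hasDerivAt r h1
  have h := HasCompactSupport.integral_Ioi_deriv_eq (f := fun r : ℝ => φ (r * e))
    ((hφ.of_le (by exact_mod_cast le_top)).comp (Complex.ofRealCLM.contDiff.mul contDiff_const))
    (hc.comp_isClosedEmbedding hiso.isClosedEmbedding) 0
  simp only [(hd _).deriv] at h
  simpa using h

/-- Up to the factor `r`, the integrand is the derivative of `φ` around a closed circle; both
endpoints are `-r`. -/
theorem integral_angular_deriv {φ : ℂ → ℂ} (hφ : ContDiff ℝ ∞ φ) {r : ℝ} (hr : 0 < r) :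
    ∫ θ in Ioo (-Real.pi) Real.pi, fderiv ℝ φ (r * Complex.exp (θ * Complex.I))
      (Complex.exp (θ * Complex.I) * Complex.I) = 0 := by
  have hd : ∀ θ : ℝ, HasDerivAt (fun θ : ℝ => φ (r * Complex.exp (θ * Complex.I)))
      (r * fderiv ℝ φ (r * Complex.exp (θ * Complex.I))
        (Complex.exp (θ * Complex.I) * Complex.I)) θ := by
    intro θ
    have h1 : HasDerivAt (fun θ : ℝ => (r : ℂ) * Complex.exp (θ * Complex.I))
        (r * (Complex.exp (θ * Complex.I) * Complex.I)) θ := by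
      have h2 : HasDerivAt (fun θ : ℝ => (θ : ℂ) * Complex.I) Complex.I θ := by
        simpa using (Complex.ofRealCLM.hasDerivAt (x := θ)).mul_const Complex.I
      exact h2.cexp.const_mul _
    have h3 := ((hφ.differentiable (by simp)).differentiableAt.hasFDerivAt).comp_hasDerivAt θ h1
    have h4 : fderiv ℝ φ (r * Complex.exp (θ * Complex.I))
        (r * (Complex.exp (θ * Complex.I) * Complex.I)) = r * fderiv ℝ φ
          (r * Complex.exp (θ * Complex.I)) (Complex.exp (θ * Complex.I) * Complex.I) := by
      rw [← Complex.real_smul (x := r) (z := _ * Complex.I), map_smul, Complex.real_smul]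
    rw [h4] at h3
    exact h3
  have hcont : Continuous fun θ : ℝ => (r : ℂ) * fderiv ℝ φ (r * Complex.exp (θ * Complex.I))
        (Complex.exp (θ * Complex.I) * Complex.I) := by
    have := hφ.continuous_fderiv (by simp)
    fun_prop
  have h := intervalIntegral.integral_eq_sub_of_hasDerivAt (a := -Real.pi) (b := Real.pi)
    (fun θ _ => hd θ) (hcont.intervalIntegrable _ _)
  rw [intervalIntegral.integral_const_mul, Complex.ofReal_neg, neg_mul, Complex.exp_neg,
    Complex.exp_pi_mul_I, intervalIntegral.integral_of_le (by linarith [Real.pi_pos]),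
    integral_Ioc_eq_integral_Ioo] at h
  have h0 : (r : ℂ) ≠ 0 := by exact_mod_cast hr.ne'
  have e : φ (r * -1) - φ (r * (-1)⁻¹) = 0 := by norm_num
  rw [e] at h
  exact (mul_eq_zero.1 h).resolve_left h0

/-- Expresses `∂/∂z̄` in the frame `e, ie`; with `e = e^{iθ}` these are the radial and angular
directions. -/
theorem dbar_rotate (φ : ℂ → ℂ) (z e : ℂ) :
    (1 / 2 : ℂ) * fderiv ℝ φ z e + Complex.I / 2 * fderiv ℝ φ z (e * Complex.I)
      = (starRingEnd ℂ) e * dbar φ z := by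
  have h : ∀ v : ℂ, fderiv ℝ φ z v
      = v.re * fderiv ℝ φ z 1 + v.im * fderiv ℝ φ z Complex.I := by
    intro v
    have hv : v = v.re • (1 : ℂ) + v.im • Complex.I := by
      simp only [Complex.real_smul, mul_one, Complex.re_add_im]
    conv_lhs => rw [hv]
    rw [map_add, map_smul, map_smul, Complex.real_smul, Complex.real_smul]
  have hc : (starRingEnd ℂ) e = e.re - e.im * Complex.I := by
    apply Complex.ext <;> simp
  rw [h e, h (e * Complex.I), dbar, hc]
  simp only [Complex.mul_I_re, Complex.mul_I_im]
  push_cast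
  linear_combination ((e.im : ℂ) / 2 * fderiv ℝ φ z Complex.I) * Complex.I_sq

/-- Cauchy-Pompeiu at the origin. In polar coordinates the Jacobian `r` cancels the singularity of
`1/ζ`, leaving a radial derivative, which integrates to `-φ(0)` on each ray, and an angular one,
which integrates to zero. -/
theorem integral_dbar_div {φ : ℂ → ℂ} (hφ : ContDiff ℝ ∞ φ) (hc : HasCompactSupport φ) :
    ∫ ζ, dbar φ ζ / ζ = -(Real.pi * φ 0) := by
  set e : ℝ → ℂ := fun θ => Complex.exp (θ * Complex.I) with he
  have hen : ∀ θ, ‖e θ‖ = 1 := fun θ => Complex.norm_exp_ofReal_mul_I θ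
  have hec : Continuous e := by fun_prop
  have hf' := hφ.continuous_fderiv (by simp)
  obtain ⟨R, hR⟩ : ∃ R : ℝ, ∀ z, R < ‖z‖ → fderiv ℝ φ z = 0 := by
    obtain ⟨R, hR⟩ := (hc.fderiv (𝕜 := ℝ)).isCompact.isBounded.subset_closedBall 0
    refine ⟨R, fun z hz => image_eq_zero_of_notMem_tsupport fun hz' => ?_⟩
    have := hR hz'
    rw [mem_closedBall_zero_iff] at this
    exact absurd hz (not_lt.2 this)
  have hzero : ∀ p : ℝ × ℝ, R < p.1 → fderiv ℝ φ (p.1 * e p.2) = 0 := fun p hp => by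
    refine hR _ ?_
    rw [norm_mul, hen, mul_one, Complex.norm_real]
    exact hp.trans_le (le_abs_self _)
  set a : ℝ × ℝ → ℂ := fun p => fderiv ℝ φ (p.1 * e p.2) (e p.2) with ha
  set b : ℝ × ℝ → ℂ := fun p => fderiv ℝ φ (p.1 * e p.2) (e p.2 * Complex.I) with hb
  have hai : IntegrableOn a (Ioi 0 ×ˢ Ioo (-Real.pi) Real.pi) :=
    integrableOn_of_continuous_of_eq_zero (R := R) (by fun_prop) fun p hp => by
      simp [ha, hzero p hp]
  have hbi : IntegrableOn b (Ioi 0 ×ˢ Ioo (-Real.pi) Real.pi) :=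
    integrableOn_of_continuous_of_eq_zero (R := R) (by fun_prop) fun p hp => by
      simp [hb, hzero p hp]
  have hA : ∫ p in Ioi 0 ×ˢ Ioo (-Real.pi) Real.pi, a p = -(2 * Real.pi * φ 0) := by
    rw [Measure.volume_eq_prod, setIntegral_prod _ (by rwa [← Measure.volume_eq_prod]),
      integral_integral_swap]
    · have : ∀ θ : ℝ, ∫ r in Ioi (0 : ℝ), a (r, θ) = -φ 0 := fun θ =>
        integral_radial_deriv hφ hc (hen θ)
      simp only [this]
      rw [setIntegral_const, measureReal_def, Real.volume_Ioo, ENNReal.toReal_ofReal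
        (by linarith [Real.pi_pos]), Complex.real_smul]
      push_cast
      ring
    · rw [Measure.prod_restrict, ← Measure.volume_eq_prod]
      exact hai
  have hB : ∫ p in Ioi 0 ×ˢ Ioo (-Real.pi) Real.pi, b p = 0 := by
    rw [Measure.volume_eq_prod, setIntegral_prod _ (by rwa [← Measure.volume_eq_prod])]
    exact setIntegral_eq_zero_of_forall_eq_zero fun r hr => integral_angular_deriv hφ hr
  rw [← Complex.integral_comp_polarCoord_symm]
  have hcongr : ∫ p in polarCoord.target, p.1 • (dbar φ (Complex.polarCoord.symm p) /
      Complex.polarCoord.symm p) = ∫ p in Ioi 0 ×ˢ Ioo (-Real.pi) Real.pi,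
        ((1 / 2 : ℂ) * a p + Complex.I / 2 * b p) := by
    refine setIntegral_congr_fun (measurableSet_Ioi.prod measurableSet_Ioo) ?_
    rintro p ⟨hp1, -⟩
    have hs : Complex.polarCoord.symm p = p.1 * e p.2 := by
      rw [Complex.polarCoord_symm_apply, he]
      simp only [Complex.exp_mul_I, Complex.ofReal_cos, Complex.ofReal_sin]
    have h0 : (p.1 : ℂ) ≠ 0 := by exact_mod_cast (ne_of_gt hp1)
    have h1 : e p.2 ≠ 0 := Complex.exp_ne_zero _
    have h2 : (starRingEnd ℂ) (e p.2) = (e p.2)⁻¹ := by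
      rw [Complex.inv_def, Complex.normSq_eq_norm_sq, hen]
      simp
    simp only [ha, hb, dbar_rotate, hs, h2, Complex.real_smul]
    field_simp
  rw [hcongr, integral_add (hai.const_mul _) (hbi.const_mul _), integral_const_mul,
    integral_const_mul, hA, hB]
  ring

/-! ### The Cauchy transform -/

/-- In polar coordinates the integrand is `y^{1-s}`, integrable at `0` because `1 - s > -1`. -/
theorem integrableOn_norm_rpow_neg {s : ℝ} (hs : s < 2) (R : ℝ) :
    IntegrableOn (fun ζ : ℂ => ‖ζ‖ ^ (-s)) (Metric.ball 0 R) := by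
  rw [integrableOn_fun_norm_addHaar (μ := volume) (f := fun y : ℝ => y ^ (-s))]
  have h := (intervalIntegral.intervalIntegrable_rpow' (a := 0) (b := R) (r := 1 - s)
    (by linarith)).1
  refine (h.mono_set Ioo_subset_Ioc_self).congr_fun (fun y hy => ?_) measurableSet_Ioo
  simp only [Complex.finrank_real_complex, smul_eq_mul, sub_eq_add_neg 1 s,
    Real.rpow_add hy.1, Real.rpow_one]
  norm_num

/-- The Cauchy kernel `1 / ζ` cut off outside the ball of radius `R`. -/
def cauchyKernel (R : ℝ) : ℂ → ℂ := (Metric.ball 0 R).indicator fun ζ => ζ⁻¹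

theorem memLp_cauchyKernel {s : ℝ} (h0 : 0 < s) (hs : s < 2) (R : ℝ) :
    MemLp (cauchyKernel R) (ENNReal.ofReal s) := by
  have hm : AEStronglyMeasurable (cauchyKernel R) :=
    (measurable_inv.indicator measurableSet_ball).aestronglyMeasurable
  rw [← integrable_norm_rpow_iff hm (by simpa using h0) ENNReal.ofReal_ne_top,
    ENNReal.toReal_ofReal h0.le]
  refine ((integrable_indicator_iff measurableSet_ball).2
    (integrableOn_norm_rpow_neg hs R)).congr (Eventually.of_forall fun ζ => ?_)
  by_cases hζ : ζ ∈ Metric.ball (0 : ℂ) R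
  · simp [cauchyKernel, hζ, Real.rpow_neg, Real.inv_rpow]
  · simp [cauchyKernel, hζ, Real.zero_rpow h0.ne']

theorem locallyIntegrable_inv : LocallyIntegrable fun ζ : ℂ => ζ⁻¹ := by
  intro x
  refine ⟨Metric.ball 0 (‖x‖ + 1), Metric.isOpen_ball.mem_nhds (by simp), ?_⟩
  rw [← integrable_indicator_iff measurableSet_ball, ← memLp_one_iff_integrable]
  have h := memLp_cauchyKernel one_pos one_lt_two (‖x‖ + 1)
  rwa [ENNReal.ofReal_one] at h

/-- The Cauchy transform `-(1/π) ∫ C(ζ) / (ζ - z)` over the whole plane. -/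
def cauchyTransform (C : ℂ → ℂ) (z : ℂ) : ℂ := -(1 / Real.pi) * ∫ ζ, C ζ / (ζ - z)

theorem psi_eq_cauchyTransform (A : ℂ → ℂ) : psi A = cauchyTransform (D.indicator A) := by
  funext z
  rw [psi, cauchyTransform, ← integral_indicator measurableSet_ball]
  congr 2
  funext ζ
  by_cases hζ : ζ ∈ D <;> simp [hζ]

/-- Turning `ζ - z` into `z - ζ` absorbs the minus sign; as a convolution the transform can be
differentiated through `B`. -/
theorem cauchyTransform_eq_convolution (B : ℂ → ℂ) :
    cauchyTransform B = convolution (fun ζ : ℂ => (1 / Real.pi : ℂ) * ζ⁻¹) B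
      (ContinuousLinearMap.mul ℝ ℂ) volume := by
  funext z
  rw [cauchyTransform, convolution_eq_swap, ← integral_const_mul]
  refine integral_congr_ae (Eventually.of_forall fun ζ => ?_)
  have : (z - ζ)⁻¹ = -(ζ - z)⁻¹ := by rw [← inv_neg, neg_sub]
  simp only [ContinuousLinearMap.mul_apply', this]
  ring

theorem contDiff_cauchyTransform {B : ℂ → ℂ} (hB : ContDiff ℝ ∞ B) (hc : HasCompactSupport B) :
    ContDiff ℝ ∞ (cauchyTransform B) := by
  rw [cauchyTransform_eq_convolution]
  exact hc.contDiff_convolution_right _ (locallyIntegrable_inv.smul (1 / Real.pi : ℂ)) hB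

/-- Derivatives of the convolution fall on `B`, giving the transform of `∂B/∂z̄`. After translation
by `z` this is `integral_dbar_div`. -/
theorem dbar_cauchyTransform {B : ℂ → ℂ} (hB : ContDiff ℝ ∞ B) (hc : HasCompactSupport B) (z : ℂ) :
    dbar (cauchyTransform B) z = B z := by
  set f : ℂ → ℂ := fun ζ => (1 / Real.pi : ℂ) * ζ⁻¹ with hf
  have hfi : LocallyIntegrable f := locallyIntegrable_inv.smul (1 / Real.pi : ℂ)
  have hd := hc.hasFDerivAt_convolution_right (ContinuousLinearMap.mul ℝ ℂ) hfi
    (hB.of_le (by exact_mod_cast le_top)) z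
  rw [← cauchyTransform_eq_convolution] at hd
  have hf' := hB.continuous_fderiv (by simp)
  have hcs : ∀ v : ℂ, HasCompactSupport fun ζ => fderiv ℝ B ζ v := fun v =>
    hc.fderiv_apply (𝕜 := ℝ) v
  have hex : ∀ v : ℂ, ConvolutionExistsAt f (fun ζ => fderiv ℝ B ζ v) z
      (ContinuousLinearMap.mul ℝ ℂ) volume := fun v =>
    (hcs v).convolutionExists_right _ hfi (by fun_prop) z
  have hv : ∀ v : ℂ, fderiv ℝ (cauchyTransform B) z v = cauchyTransform (fun ζ => fderiv ℝ B ζ v) z := by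
    intro v
    rw [hd.fderiv, cauchyTransform_eq_convolution]
    exact convolution_precompR_apply _ hfi (hc.fderiv (𝕜 := ℝ)) hf' z v
  have hint : ∀ v : ℂ, Integrable fun ζ => fderiv ℝ B ζ v / (ζ - z) := by
    intro v
    have h1 := (locallyIntegrable_inv.integrable_smul_right_of_hasCompactSupport
      (g := fun ζ => fderiv ℝ B (ζ + z) v) (by fun_prop)
      ((hcs v).comp_homeomorph (Homeomorph.addRight z))).comp_sub_right z
    refine h1.congr (Eventually.of_forall fun ζ => ?_)
    simp [div_eq_mul_inv, mul_comm]
  have hsum : dbar (cauchyTransform B) z = cauchyTransform (dbar B) z := by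
    have e : ∀ ζ, dbar B ζ / (ζ - z) = (1 / 2) * (fderiv ℝ B ζ 1 / (ζ - z)
        + Complex.I * (fderiv ℝ B ζ Complex.I / (ζ - z))) := fun ζ => by
      rw [dbar]
      ring
    rw [dbar, hv, hv]
    simp only [cauchyTransform, e]
    rw [integral_const_mul, integral_add (hint 1) ((hint _).const_mul _), integral_const_mul]
    ring
  have htr : ∀ ζ, dbar (fun ξ => B (ξ + z)) ζ = dbar B (ζ + z) := fun ζ => by
    simp only [dbar, fderiv_comp_add_right]
  have hP := integral_dbar_div (φ := fun ξ => B (ξ + z)) (hB.comp (contDiff_id.add contDiff_const))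
    (hc.comp_homeomorph (Homeomorph.addRight z))
  rw [hsum, cauchyTransform, ← integral_add_right_eq_self _ z]
  simp only [htr, zero_add] at hP
  simp only [add_sub_cancel_right, hP]
  have hpi : (Real.pi : ℂ) ≠ 0 := by exact_mod_cast Real.pi_ne_zero
  field_simp

/-! ### Bounds for the Cauchy transform -/

/-- For `|ζ| < 2` and `|z| < 1` one has `|ζ - z| < 3`, so the cut-off at `3` is invisible. -/
theorem div_sub_eq_mul_cauchyKernel {C : ℂ → ℂ} (hC : ∀ ζ, ζ ∉ Metric.ball (0 : ℂ) 2 → C ζ = 0)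
    {z : ℂ} (hz : z ∈ D) (ζ : ℂ) : C ζ / (ζ - z) = C ζ * cauchyKernel 3 (ζ - z) := by
  by_cases hζ : ζ ∈ Metric.ball (0 : ℂ) 2
  · rw [mem_ball_zero_iff] at hζ hz
    have : ζ - z ∈ Metric.ball (0 : ℂ) 3 := by
      rw [mem_ball_zero_iff]
      linarith [norm_sub_le ζ z]
    rw [cauchyKernel, indicator_of_mem this, div_eq_mul_inv]
  · simp [hC ζ hζ]

/-- For `C ∈ L^p` supported in the ball of radius `2`, with `p > 2`, the Cauchy integral converges
on the unit disk and is bounded there by a multiple of the `L^p` norm. -/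
theorem exists_cauchy_bound {a : ℝ} (ha : 2 < a) : ∃ M : ℝ, 0 ≤ M ∧ ∀ C : ℂ → ℂ,
    MemLp C (ENNReal.ofReal a) → (∀ ζ, ζ ∉ Metric.ball (0 : ℂ) 2 → C ζ = 0) → ∀ z ∈ D,
      Integrable (fun ζ => C ζ / (ζ - z)) ∧
      ‖∫ ζ, C ζ / (ζ - z)‖ ≤ M * (eLpNorm C (ENNReal.ofReal a) volume).toReal := by
  have hab : a.HolderConjugate (a.conjExponent) := Real.HolderConjugate.conjExponent (by linarith)
  set b := a.conjExponent with hb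
  -- The conjugate exponent `a/(a-1)` is below `2` because `a > 2`; this puts the kernel in `L^b`.
  -- By translation invariance its norm does not depend on `z`.
  have hb2 : b < 2 := by
    rw [hb, Real.conjExponent, div_lt_iff₀ (by linarith)]
    linarith
  have hk : MemLp (cauchyKernel 3) (ENNReal.ofReal b) := memLp_cauchyKernel hab.symm.pos hb2 3
  have : ENNReal.HolderConjugate (ENNReal.ofReal a) (ENNReal.ofReal b) := hab.ennrealOfReal
  refine ⟨(eLpNorm (cauchyKernel 3) (ENNReal.ofReal b) volume).toReal, ENNReal.toReal_nonneg,
    fun C hC hC0 z hz => ?_⟩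
  have hmp := measurePreserving_sub_right (volume : Measure ℂ) z
  have hk' : MemLp (fun ζ => cauchyKernel 3 (ζ - z)) (ENNReal.ofReal b) :=
    hk.comp_measurePreserving hmp
  have hkn : eLpNorm (fun ζ => cauchyKernel 3 (ζ - z)) (ENNReal.ofReal b) volume
      = eLpNorm (cauchyKernel 3) (ENNReal.ofReal b) volume :=
    eLpNorm_comp_measurePreserving hk.1 hmp
  simp only [div_sub_eq_mul_cauchyKernel hC0 hz]
  have hi : Integrable fun ζ => C ζ * cauchyKernel 3 (ζ - z) := hC.integrable_mul hk'
  refine ⟨hi, ?_⟩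
  have h1 : eLpNorm (fun ζ => C ζ * cauchyKernel 3 (ζ - z)) 1 volume
      ≤ eLpNorm C (ENNReal.ofReal a) volume
        * eLpNorm (fun ζ => cauchyKernel 3 (ζ - z)) (ENNReal.ofReal b) volume :=
    eLpNorm_smul_le_mul_eLpNorm (p := ENNReal.ofReal a) (q := ENNReal.ofReal b) (r := 1)
      (f := fun ζ => cauchyKernel 3 (ζ - z)) (φ := C) hk'.1 hC.1
  rw [hkn] at h1
  calc ‖∫ ζ, C ζ * cauchyKernel 3 (ζ - z)‖ ≤ ∫ ζ, ‖C ζ * cauchyKernel 3 (ζ - z)‖ :=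
        norm_integral_le_integral_norm _
    _ = (eLpNorm (fun ζ => C ζ * cauchyKernel 3 (ζ - z)) 1 volume).toReal := by
        rw [integral_norm_eq_lintegral_enorm hi.1, eLpNorm_one_eq_lintegral_enorm]
    _ ≤ _ := by
        rw [← ENNReal.toReal_mul, mul_comm (eLpNorm (cauchyKernel 3) _ _)]
        exact ENNReal.toReal_mono (ENNReal.mul_ne_top hC.eLpNorm_ne_top hk.eLpNorm_ne_top) h1

/-- Any smooth approximation may be multiplied by a bump that is `1` on the disk: off the disk the
target is `0` and the bump is at most `1`, so the error does not grow. -/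
theorem exists_smooth_approx {p : ℝ≥0∞} (hp : p ≠ ⊤) (hp1 : 1 ≤ p) {A : ℂ → ℂ}
    (hA : MemLp (D.indicator A) p) {ε : ℝ} (hε : 0 < ε) :
    ∃ B : ℂ → ℂ, ContDiff ℝ ∞ B ∧ HasCompactSupport B ∧
      (∀ ζ, ζ ∉ Metric.ball (0 : ℂ) 2 → B ζ = 0) ∧
      eLpNorm (D.indicator A - B) p volume ≤ ENNReal.ofReal ε := by
  obtain ⟨g, hg1, hg2, hg3⟩ := hA.exist_eLpNorm_sub_le hp hp1 hε
  let χ : ContDiffBump (0 : ℂ) := ⟨1, 2, one_pos, one_lt_two⟩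
  have hχ : ContDiff ℝ ∞ fun z => (χ z : ℂ) := Complex.ofRealCLM.contDiff.comp χ.contDiff
  refine ⟨fun z => χ z * g z, hχ.mul hg2, hg1.mul_left, fun ζ hζ => ?_, ?_⟩
  · have h0 : χ ζ = 0 := χ.zero_of_le_dist (by simpa using hζ)
    simp [h0]
  · refine (eLpNorm_mono fun z => ?_).trans hg3
    by_cases hz : z ∈ D
    · have h1 : χ z = 1 := χ.one_of_mem_closedBall (Metric.ball_subset_closedBall hz)
      simp [h1]
    · simp only [Pi.sub_apply, indicator_of_notMem hz, zero_sub, norm_neg, norm_mul,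
        Complex.norm_real, Real.norm_of_nonneg χ.nonneg]
      exact mul_le_of_le_one_left (norm_nonneg _) χ.le_one

instance : IsFiniteMeasure (volume.restrict D) :=
  ⟨by rw [Measure.restrict_apply_univ]; exact measure_ball_lt_top⟩

/-- Approximation of `ψ` by smooth Cauchy transforms: the approximations converge pointwise on the
disk, are uniformly bounded there, and their `∂/∂z̄` derivatives converge to `A` in `L¹(D)`. -/
theorem exists_approx_psi {q : ℝ≥0∞} (hq : 2 < q) {A : ℂ → ℂ}
    (hA : MemLp A q (volume.restrict D)) :
    ∃ (v B : ℕ → ℂ → ℂ) (K : ℝ), (∀ j, ContDiff ℝ ∞ (v j)) ∧ (∀ j, Continuous (B j)) ∧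
      (∀ j z, dbar (v j) z = B j z) ∧ (∀ j, ∀ z ∈ D, ‖v j z‖ ≤ K) ∧
      (∀ z ∈ D, Tendsto (fun j => v j z) atTop (𝓝 (psi A z))) ∧
      Tendsto (fun j => ∫ z in D, ‖B j z - A z‖) atTop (𝓝 0) := by
  -- Smooth functions are dense only for finite exponents, and `q` may be infinite. A real `a`
  -- strictly between `2` and `q` suffices on the finite-measure disk.
  obtain ⟨a, ha0, ha2, haq⟩ := ENNReal.lt_iff_exists_real_btwn.1 hq
  have ha : 2 < a := by
    have : ENNReal.ofReal 2 < ENNReal.ofReal a := by simpa using ha2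
    exact (ENNReal.ofReal_lt_ofReal_iff_of_nonneg (by norm_num)).1 this
  set p := ENNReal.ofReal a with hp
  have hp1 : 1 ≤ p := le_trans (by norm_num) ha2.le
  have hAp : MemLp A p (volume.restrict D) := hA.mono_exponent haq.le
  have hAi : MemLp (D.indicator A) p := (memLp_indicator_iff_restrict measurableSet_ball).2 hAp
  have hA0 : ∀ ζ, ζ ∉ Metric.ball (0 : ℂ) 2 → D.indicator A ζ = 0 := fun ζ hζ =>
    indicator_of_notMem (fun h => hζ (Metric.ball_subset_ball one_le_two h)) _
  obtain ⟨M, hM0, hM⟩ := exists_cauchy_bound ha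
  choose B hB1 hB2 hB3 hB4 using fun j : ℕ =>
    exists_smooth_approx ENNReal.ofReal_ne_top hp1 hAi (ε := 1 / ((j : ℝ) + 1)) (by positivity)
  have hBp : ∀ j, MemLp (B j) p := fun j => (hB1 j).continuous.memLp_of_hasCompactSupport (hB2 j)
  have hdiff : ∀ j, ∀ z ∈ D,
      ‖cauchyTransform (B j) z - psi A z‖ ≤ 1 / Real.pi * (M * (1 / ((j : ℝ) + 1))) := by
    intro j z hz
    have h1 := hM _ (hAi.sub (hBp j)) (fun ζ hζ => by simp [hA0 ζ hζ, hB3 j ζ hζ]) z hz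
    have e : cauchyTransform (B j) z - psi A z
        = (1 / Real.pi : ℂ) * ∫ ζ, (D.indicator A - B j) ζ / (ζ - z) := by
      simp only [psi_eq_cauchyTransform, cauchyTransform, Pi.sub_apply, sub_div]
      rw [integral_sub (hM _ hAi hA0 z hz).1 (hM _ (hBp j) (hB3 j) z hz).1]
      ring
    have hn : ‖(1 / Real.pi : ℂ)‖ = 1 / Real.pi := by
      rw [norm_div, norm_one, Complex.norm_real, Real.norm_of_nonneg Real.pi_pos.le]
    rw [e, norm_mul, hn]
    refine mul_le_mul_of_nonneg_left (h1.2.trans (mul_le_mul_of_nonneg_left ?_ hM0))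
      (by positivity)
    exact ENNReal.toReal_le_of_le_ofReal (by positivity) (hB4 j)
  have hlim : Tendsto (fun j : ℕ => 1 / Real.pi * (M * (1 / ((j : ℝ) + 1)))) atTop (𝓝 0) := by
    simpa using (tendsto_one_div_add_atTop_nhds_zero_nat (𝕜 := ℝ)).const_mul M |>.const_mul
      (1 / Real.pi)
  refine ⟨fun j => cauchyTransform (B j), B,
    1 / Real.pi * M + 1 / Real.pi * (M * (eLpNorm (D.indicator A) p volume).toReal),
    fun j => contDiff_cauchyTransform (hB1 j) (hB2 j), fun j => (hB1 j).continuous,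
    fun j => dbar_cauchyTransform (hB1 j) (hB2 j), fun j z hz => ?_, fun z hz => ?_, ?_⟩
  · have h1 : ‖psi A z‖ ≤ 1 / Real.pi * (M * (eLpNorm (D.indicator A) p volume).toReal) := by
      rw [psi_eq_cauchyTransform, cauchyTransform, norm_mul, norm_neg, norm_div, norm_one,
        Complex.norm_real, Real.norm_of_nonneg Real.pi_pos.le]
      exact mul_le_mul_of_nonneg_left (hM _ hAi hA0 z hz).2 (by positivity)
    have h2 : 1 / Real.pi * (M * (1 / ((j : ℝ) + 1))) ≤ 1 / Real.pi * M := by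
      refine mul_le_mul_of_nonneg_left (mul_le_of_le_one_right hM0 ?_) (by positivity)
      rw [div_le_one (by positivity)]
      linarith [(Nat.cast_nonneg j : (0 : ℝ) ≤ j)]
    have h3 := norm_add_le (cauchyTransform (B j) z - psi A z) (psi A z)
    rw [sub_add_cancel] at h3
    linarith [hdiff j z hz]
  · rw [tendsto_iff_norm_sub_tendsto_zero]
    exact squeeze_zero (fun _ => norm_nonneg _) (fun j => hdiff j z hz) hlim
  -- `V` is the Hölder constant bounding the `L¹` norm on the disk by the `L^p` norm.
  · set V := (volume.restrict D univ) ^ (1 / (1 : ℝ≥0∞).toReal - 1 / p.toReal) with hV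
    have hVt : V ≠ ⊤ := by
      refine (ENNReal.rpow_lt_top_of_nonneg ?_ (measure_ne_top _ _)).ne
      rw [hp, ENNReal.toReal_ofReal ha0, ENNReal.toReal_one, sub_nonneg]
      exact one_div_le_one_div_of_le one_pos (by linarith)
    refine squeeze_zero (g := fun j : ℕ => 1 / ((j : ℝ) + 1) * V.toReal)
      (fun j => integral_nonneg fun _ => norm_nonneg _) (fun j => ?_) ?_
    · have hm : AEStronglyMeasurable (fun z => B j z - A z) (volume.restrict D) :=
        (hB1 j).continuous.aestronglyMeasurable.sub hA.1
      have h1 : eLpNorm (fun z => B j z - A z) p (volume.restrict D)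
          ≤ ENNReal.ofReal (1 / ((j : ℝ) + 1)) := by
        refine le_trans ?_ (hB4 j)
        refine le_trans (le_of_eq ?_) (eLpNorm_mono_measure _ (Measure.restrict_le_self (s := D)))
        refine eLpNorm_congr_norm_ae ?_
        filter_upwards [ae_restrict_mem measurableSet_ball] with z hz
        rw [Pi.sub_apply, indicator_of_mem hz, norm_sub_rev]
      rw [integral_norm_eq_lintegral_enorm hm, ← eLpNorm_one_eq_lintegral_enorm,
        ← ENNReal.toReal_ofReal (show 0 ≤ 1 / ((j : ℝ) + 1) by positivity), ← ENNReal.toReal_mul]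
      refine ENNReal.toReal_mono (ENNReal.mul_ne_top ENNReal.ofReal_ne_top hVt) ?_
      exact (eLpNorm_le_eLpNorm_mul_rpow_measure_univ hp1 hm).trans (by gcongr)
    · simpa using (tendsto_one_div_add_atTop_nhds_zero_nat (𝕜 := ℝ)).mul_const V.toReal

/-! ### Weak derivatives -/

theorem continuous_dbar {φ : ℂ → ℂ} (hφ : ContDiff ℝ ∞ φ) : Continuous (dbar φ) := by
  have := hφ.continuous_fderiv (by simp)
  unfold dbar
  fun_prop

theorem support_dbar_subset (φ : ℂ → ℂ) : Function.support (dbar φ) ⊆ tsupport φ := by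
  intro z hz
  by_contra h
  have h0 : fderiv ℝ φ z = 0 :=
    image_eq_zero_of_notMem_tsupport fun h' => h (tsupport_fderiv_subset ℝ h')
  exact hz (by simp [dbar, h0])

theorem hasCompactSupport_dbar {φ : ℂ → ℂ} (hc : HasCompactSupport φ) :
    HasCompactSupport (dbar φ) :=
  hc.mono' (support_dbar_subset φ)

theorem integral_mul_dbar {u φ : ℂ → ℂ} (hu : ContDiff ℝ ∞ u) (hφ : ContDiff ℝ ∞ φ)
    (hc : HasCompactSupport φ) : ∫ z, u z * dbar φ z = -∫ z, dbar u z * φ z := by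
  have hu' := hu.continuous_fderiv (by simp)
  have hφ' := hφ.continuous_fderiv (by simp)
  have hu0 := hu.continuous
  have hφ0 := hφ.continuous
  have h1 : ∀ v, Integrable fun z => fderiv ℝ u z v * φ z := fun v =>
    Continuous.integrable_of_hasCompactSupport (by fun_prop) hc.mul_left
  have h2 : ∀ v, Integrable fun z => u z * fderiv ℝ φ z v := fun v =>
    Continuous.integrable_of_hasCompactSupport (by fun_prop) (hc.fderiv_apply (𝕜 := ℝ) v).mul_left
  have h3 : Integrable fun z => u z * φ z :=
    Continuous.integrable_of_hasCompactSupport (by fun_prop) hc.mul_left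
  have hv : ∀ v, ∫ z, u z * fderiv ℝ φ z v = -∫ z, fderiv ℝ u z v * φ z := fun v =>
    integral_mul_fderiv_eq_neg_fderiv_mul_of_integrable (h1 v) (h2 v) h3
      (fun z _ => hu.differentiable (by simp) z) (fun z _ => hφ.differentiable (by simp) z)
  have e1 : ∀ z, u z * dbar φ z = (1 / 2) * (u z * fderiv ℝ φ z 1
      + Complex.I * (u z * fderiv ℝ φ z Complex.I)) := fun z => by rw [dbar]; ring
  have e2 : ∀ z, dbar u z * φ z = (1 / 2) * (fderiv ℝ u z 1 * φ z
      + Complex.I * (fderiv ℝ u z Complex.I * φ z)) := fun z => by rw [dbar]; ring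
  simp only [e1, e2]
  rw [integral_const_mul, integral_const_mul, integral_add (h2 _) ((h2 _).const_mul _),
    integral_add (h1 _) ((h1 _).const_mul _), integral_const_mul, integral_const_mul, hv, hv]
  ring

theorem setIntegral_mul_dbar {u φ : ℂ → ℂ} (hu : ContDiff ℝ ∞ u) (hφ : IsTestOnDisk φ) :
    ∫ z in D, u z * dbar φ z = -∫ z in D, dbar u z * φ z := by
  rw [setIntegral_eq_integral_of_forall_compl_eq_zero,
    setIntegral_eq_integral_of_forall_compl_eq_zero, integral_mul_dbar hu hφ.1 hφ.2.1]
  · intro z hz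
    rw [image_eq_zero_of_notMem_tsupport fun h => hz (hφ.2.2 h), mul_zero]
  · intro z hz
    rw [Function.notMem_support.1 fun h => hz (hφ.2.2 (support_dbar_subset φ h)), mul_zero]

/-- Split `F_j u_j = (F_j - G) u_j + G u_j`: the first part is controlled by the `L¹` error times
`K`, the second by dominated convergence. -/
theorem tendsto_setIntegral_mul {F : ℕ → ℂ → ℂ} {G : ℂ → ℂ} {u : ℕ → ℂ → ℂ} {v : ℂ → ℂ} {K : ℝ}
    {s : Set ℂ} (hs : MeasurableSet s)
    (hF : ∀ j, IntegrableOn (F j) s) (hG : IntegrableOn G s)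
    (hFG : Tendsto (fun j => ∫ z in s, ‖F j z - G z‖) atTop (𝓝 0))
    (hu : ∀ j, AEStronglyMeasurable (u j) (volume.restrict s)) (hK : ∀ j, ∀ z ∈ s, ‖u j z‖ ≤ K)
    (hlim : ∀ z ∈ s, Tendsto (fun j => u j z) atTop (𝓝 (v z))) :
    Tendsto (fun j => ∫ z in s, F j z * u j z) atTop (𝓝 (∫ z in s, G z * v z)) := by
  have hKae : ∀ j, ∀ᵐ z ∂volume.restrict s, ‖u j z‖ ≤ K := fun j => by
    filter_upwards [ae_restrict_mem hs] with z hz using hK j z hz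
  have h1 : Tendsto (fun j => ∫ z in s, (F j z - G z) * u j z) atTop (𝓝 0) := by
    refine squeeze_zero_norm (a := fun j => (∫ z in s, ‖F j z - G z‖) * K) (fun j => ?_)
      (by simpa using hFG.mul_const K)
    rw [← integral_mul_const]
    refine norm_integral_le_of_norm_le (((hF j).sub hG).norm.mul_const K) ?_
    filter_upwards [hKae j] with z hz
    rw [norm_mul]
    exact mul_le_mul_of_nonneg_left hz (norm_nonneg _)
  have h2 : Tendsto (fun j => ∫ z in s, G z * u j z) atTop (𝓝 (∫ z in s, G z * v z)) := by
    refine tendsto_integral_of_dominated_convergence (fun z => ‖G z‖ * K)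
      (fun j => hG.1.mul (hu j)) (hG.norm.mul_const K) (fun j => ?_) ?_
    · filter_upwards [hKae j] with z hz
      rw [norm_mul]
      exact mul_le_mul_of_nonneg_left hz (norm_nonneg _)
    · filter_upwards [ae_restrict_mem hs] with z hz using (hlim z hz).const_mul _
  have h3 := h1.add h2
  rw [zero_add] at h3
  refine h3.congr fun j => ?_
  have i1 : IntegrableOn (fun z => (F j z - G z) * u j z) s :=
    ((hF j).sub hG).mul_bdd (hu j) (hKae j)
  rw [← integral_add i1 (hG.mul_bdd (hu j) (hKae j))]
  exact integral_congr_ae (Eventually.of_forall fun z => by simp only []; ring)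

/-- The weak form of `∂(e^ψ)/∂z̄ = A e^ψ`. It holds classically for `e^{v_j}` with `B_j` in place of
`A`. The uniform bound on `v_j` bounds `e^{v_j}`, so both sides of the integrated identity pass to
the limit. -/
theorem exp_psi_weak {q : ℝ≥0∞} (hq : 2 < q) {A : ℂ → ℂ} (hA : MemLp A q (volume.restrict D)) :
    AEStronglyMeasurable (fun z => Complex.exp (psi A z)) (volume.restrict D) ∧
    (∃ K : ℝ, ∀ z ∈ D, ‖Complex.exp (psi A z)‖ ≤ K) ∧
    ∀ φ, IsTestOnDisk φ → ∫ z in D, dbar φ z * Complex.exp (psi A z)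
      = -∫ z in D, A z * φ z * Complex.exp (psi A z) := by
  obtain ⟨v, B, K, hv, hB, hvB, hK, hlim, hBA⟩ := exists_approx_psi hq hA
  have hAi : IntegrableOn A D := hA.integrable (le_trans (by norm_num) hq.le)
  have hu : ∀ j, ContDiff ℝ ∞ fun z => Complex.exp (v j z) := fun j => (hv j).cexp
  have hul : ∀ z ∈ D, Tendsto (fun j => Complex.exp (v j z)) atTop
      (𝓝 (Complex.exp (psi A z))) := fun z hz =>
    (Complex.continuous_exp.tendsto _).comp (hlim z hz)
  have huK : ∀ j, ∀ z ∈ D, ‖Complex.exp (v j z)‖ ≤ Real.exp K := fun j z hz => by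
    rw [Complex.norm_exp]
    exact Real.exp_le_exp.2 ((Complex.re_le_norm _).trans (hK j z hz))
  have hum : ∀ j, AEStronglyMeasurable (fun z => Complex.exp (v j z)) (volume.restrict D) :=
    fun j => (hu j).continuous.aestronglyMeasurable
  refine ⟨aestronglyMeasurable_of_tendsto_ae atTop hum ?_, ⟨Real.exp K, fun z hz =>
    le_of_tendsto (hul z hz).norm (Eventually.of_forall fun j => huK j z hz)⟩, fun φ hφ => ?_⟩
  · filter_upwards [ae_restrict_mem measurableSet_ball] with z hz using hul z hz
  have hφb : ∃ R : ℝ, ∀ z, ‖φ z‖ ≤ R := hφ.1.continuous.bounded_above_of_compact_support hφ.2.1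
  obtain ⟨R, hR⟩ := hφb
  have hφi : ∀ {F : ℂ → ℂ}, IntegrableOn F D → IntegrableOn (fun z => F z * φ z) D := fun hF =>
    hF.mul_bdd hφ.1.continuous.aestronglyMeasurable (Eventually.of_forall hR)
  have hBi : ∀ j, IntegrableOn (B j) D := fun j =>
    ((hB j).continuousOn.integrableOn_compact (isCompact_closedBall (0 : ℂ) 1)).mono_set
      Metric.ball_subset_closedBall
  have hdi : IntegrableOn (dbar φ) D :=
    ((continuous_dbar hφ.1).integrable_of_hasCompactSupport
      (hasCompactSupport_dbar hφ.2.1)).integrableOn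
  have t1 := tendsto_setIntegral_mul (F := fun _ => dbar φ) measurableSet_ball (fun _ => hdi) hdi
    (by simp) hum huK hul
  have t2 := tendsto_setIntegral_mul (F := fun j z => B j z * φ z) measurableSet_ball
    (fun j => hφi (hBi j)) (hφi hAi) (squeeze_zero (fun j => integral_nonneg fun _ => norm_nonneg _)
      (fun j => ?_) (by simpa using hBA.mul_const R)) hum huK hul
  · refine tendsto_nhds_unique t1 (t2.neg.congr fun j => ?_)
    have h := setIntegral_mul_dbar (hu j) hφ
    have hd : ∀ z, dbar (fun z => Complex.exp (v j z)) z = Complex.exp (v j z) * B j z := fun z => by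
      rw [dbar_comp Complex.differentiable_exp.differentiableAt
        ((hv j).differentiable (by simp) z), Complex.deriv_exp, hvB]
    simp only [hd] at h
    simp only [mul_comm (dbar φ _)]
    rw [h]
    congr 1
    exact integral_congr_ae (Eventually.of_forall fun z => by simp only []; ring)
  · rw [← integral_mul_const]
    refine integral_mono ((hφi (hBi j)).sub (hφi hAi)).norm (((hBi j).sub hAi).norm.mul_const R)
      fun z => ?_
    simp only [← sub_mul, norm_mul]
    exact mul_le_mul_of_nonneg_left (hR z) (norm_nonneg _)

/-! ### The product rule and the iterated equation -/

theorem isTestOnDisk_mul {f φ : ℂ → ℂ} (hf : ContDiffOn ℝ ∞ f D) (hφ : IsTestOnDisk φ) :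
    IsTestOnDisk fun z => f z * φ z := by
  have hsub : tsupport (fun z => f z * φ z) ⊆ tsupport φ := tsupport_mul_subset_right
  refine ⟨contDiff_iff_contDiffAt.2 fun z => ?_, hφ.2.1.mul_left, hsub.trans hφ.2.2⟩
  by_cases hz : z ∈ tsupport fun z => f z * φ z
  · exact (hf.contDiffAt (Metric.isOpen_ball.mem_nhds (hφ.2.2 (hsub hz)))).mul hφ.1.contDiffAt
  -- Off its support the product is locally zero, so the behaviour of `f` outside the disk does not
  -- matter.
  · exact contDiffAt_const.congr_of_eventuallyEq (notMem_tsupport_iff_eventuallyEq.1 hz)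

/-- The product rule for `e^ψ f` with `f` smooth. -/
theorem hasWeakDbar_exp_psi_mul {q : ℝ≥0∞} (hq : 2 < q) {A : ℂ → ℂ}
    (hA : MemLp A q (volume.restrict D)) {f g : ℂ → ℂ} (hf : ContDiffOn ℝ ∞ f D)
    (hg : ContDiffOn ℝ ∞ g D) (hfg : ∀ z ∈ D, dbar f z = g z) :
    HasWeakDbar (fun z => Complex.exp (psi A z) * f z)
      (fun z => Complex.exp (psi A z) * g z + A z * (Complex.exp (psi A z) * f z)) := by
  obtain ⟨hm, ⟨K, hK⟩, hw⟩ := exp_psi_weak hq hA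
  have hAi : IntegrableOn A D := hA.integrable (le_trans (by norm_num) hq.le)
  have hexp : ∀ {k : Set ℂ}, k ⊆ D → MeasurableSet k → ∀ {G : ℂ → ℂ}, IntegrableOn G k →
      IntegrableOn (fun z => G z * Complex.exp (psi A z)) k := fun {k} hk hkm {G} hG =>
    hG.mul_bdd (hm.mono_measure (Measure.restrict_mono_set _ hk))
      (by filter_upwards [ae_restrict_mem hkm] with z hz using hK z (hk hz))
  have hloc : ∀ {f : ℂ → ℂ}, ContinuousOn f D →
      LocallyIntegrableOn (fun z => Complex.exp (psi A z) * f z) D := fun hf => by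
    rw [locallyIntegrableOn_iff (Metric.isOpen_ball.isLocallyClosed)]
    intro k hk hkc
    simpa only [mul_comm] using
      hexp hk hkc.measurableSet ((hf.mono hk).integrableOn_compact hkc)
  refine ⟨hloc hf.continuousOn, (hloc hg.continuousOn).add ?_, fun φ hφ => ?_⟩
  · rw [locallyIntegrableOn_iff (Metric.isOpen_ball.isLocallyClosed)]
    intro k hk hkc
    refine (hexp hk hkc.measurableSet ((hAi.mono_set hk).mul_continuousOn
      (hf.continuousOn.mono hk) hkc)).congr (Eventually.of_forall fun z => ?_)
    simp only []
    ring
  -- Since `f ∂φ/∂z̄ = ∂(fφ)/∂z̄ - gφ`, the smooth factor moves into the test function and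
  -- `exp_psi_weak` is applied to `fφ`.
  · have hfφ := isTestOnDisk_mul hf hφ
    have hgφ := isTestOnDisk_mul hg hφ
    have i1 : IntegrableOn (fun z => dbar (fun z => f z * φ z) z * Complex.exp (psi A z)) D :=
      hexp subset_rfl measurableSet_ball ((continuous_dbar hfφ.1).integrable_of_hasCompactSupport
        (hasCompactSupport_dbar hfφ.2.1)).integrableOn
    have i2 : IntegrableOn (fun z => g z * φ z * Complex.exp (psi A z)) D :=
      hexp subset_rfl measurableSet_ball
        (hgφ.1.continuous.integrable_of_hasCompactSupport hgφ.2.1).integrableOn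
    obtain ⟨R, hR⟩ := hfφ.1.continuous.bounded_above_of_compact_support hfφ.2.1
    have i3 : IntegrableOn (fun z => A z * (f z * φ z) * Complex.exp (psi A z)) D :=
      hexp subset_rfl measurableSet_ball
        (hAi.mul_bdd hfφ.1.continuous.aestronglyMeasurable (Eventually.of_forall hR))
    have e1 : ∫ z in D, Complex.exp (psi A z) * f z * dbar φ z
        = ∫ z in D, (dbar (fun z => f z * φ z) z * Complex.exp (psi A z)
          - g z * φ z * Complex.exp (psi A z)) := by
      refine setIntegral_congr_fun measurableSet_ball fun z hz => ?_
      rw [dbar_mul ((hf.contDiffAt (Metric.isOpen_ball.mem_nhds hz)).differentiableAt (by simp))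
        (hφ.1.differentiable (by simp) z), hfg z hz]
      ring
    have e2 : ∫ z in D, (Complex.exp (psi A z) * g z + A z * (Complex.exp (psi A z) * f z)) * φ z
        = ∫ z in D, (g z * φ z * Complex.exp (psi A z)
          + A z * (f z * φ z) * Complex.exp (psi A z)) :=
      integral_congr_ae (Eventually.of_forall fun z => by simp only []; ring)
    rw [e1, e2, integral_sub i1 i2, integral_add i2 i3, hw _ hfφ]
    ring

theorem MemSobolev.memLp {q : ℝ≥0∞} {k : ℕ} {f : ℂ → ℂ} (hf : MemSobolev q k f) :
    MemLp f q (volume.restrict D) := by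
  cases k with
  | zero => exact hf
  | succ k => exact hf.1

/-- Each application of `∂/∂z̄ - A` turns `e^ψ f_k` into `e^ψ f_{k-1}`: the term with `A` from the
product rule cancels exactly. -/
theorem solvesMeta_exp_psi_mul_polyF {q : ℝ≥0∞} (hq : 2 < q) {A : ℂ → ℂ}
    (hA : MemLp A q (volume.restrict D)) {n : ℕ} {h : ℕ → ℂ → ℂ}
    (hh : ∀ k, k < n → MemHb (h k)) (c : ℕ → ℝ) {k : ℕ} (hk : k ≤ n) :
    SolvesMeta A k fun z => Complex.exp (psi A z) * polyF h c k z := by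
  induction k with
  | zero =>
    simp only [SolvesMeta, polyF_zero, mul_zero]
    exact EventuallyEq.rfl
  | succ k ih =>
    refine ⟨_, hasWeakDbar_exp_psi_mul hq hA (contDiffOn_polyF hh c hk)
      (contDiffOn_polyF hh c (k := k) (by omega)) fun z hz => dbar_polyF hh c (by omega) hk hz, ?_⟩
    simpa only [add_sub_cancel_right] using ih (by omega)

end SchwarzMeta

end

/-! ### The main theorem -/

theorem mainTheorem4 (n : ℕ) (hn : 1 ≤ n) (q : ENNReal) (hq : 2 < q) (A : ℂ → ℂ)
    (hA : SchwarzMeta.MemSobolev q (n - 1) A)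
    (h : ℕ → ℂ → ℂ) (hh : ∀ k, k < n → SchwarzMeta.MemHb (h k)) (c : ℕ → ℝ)
    (f : ℕ → ℂ → ℂ) (hf : f = SchwarzMeta.polyF h c)
    (w : ℂ → ℂ) (hw : w = SchwarzMeta.metaW A h c n)
    (F : ℂ → ℂ) (hF : F = fun z => w z / Complex.exp (SchwarzMeta.psi A z)) :
    -- each `f_k` solves its Schwarz problem
    (∀ k, 1 ≤ k → k ≤ n →
      ContDiffOn ℝ ∞ (f k) SchwarzMeta.D ∧
      (∀ z ∈ SchwarzMeta.D, SchwarzMeta.dbar (f k) z = f (k - 1) z) ∧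
      SchwarzMeta.HasBdryValue (f k) ∧
      SchwarzMeta.reDist (SchwarzMeta.bdryValue (f k))
        = SchwarzMeta.reDist (SchwarzMeta.bdryData h f k) ∧
      (f k 0).im = c (k - 1)) ∧
    -- `w` solves the Schwarz problem for the operator `(∂/∂z̄ - A)^n`
    SchwarzMeta.SolvesMeta A n w ∧
    ContDiffOn ℝ ∞ F SchwarzMeta.D ∧
    (∀ k, k < n →
      SchwarzMeta.HasBdryValue (SchwarzMeta.dbar^[k] F) ∧
      SchwarzMeta.reDist (SchwarzMeta.bdryValue (SchwarzMeta.dbar^[k] F))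
        = SchwarzMeta.reDist (SchwarzMeta.bdryValue (f (n - k))) ∧
      SchwarzMeta.reDist (SchwarzMeta.bdryValue (f (n - k)))
        = SchwarzMeta.reDist (SchwarzMeta.bdryData h f (n - k)) ∧
      (SchwarzMeta.dbar^[k] F 0).im = c (n - 1 - k)) := by
  subst hf hw
  -- The exponential never vanishes, so the identity holds on the whole plane and reduces every
  -- claim about `F` to one about `f_n`.
  have hFn : F = SchwarzMeta.polyF h c n := by
    rw [hF]
    funext z
    rw [SchwarzMeta.metaW, mul_div_cancel_left₀ _ (Complex.exp_ne_zero _),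
      SchwarzMeta.polyF_eq h c n hn]
  refine ⟨fun k hk hkn => ⟨SchwarzMeta.contDiffOn_polyF hh c hkn,
    fun z hz => SchwarzMeta.dbar_polyF hh c hk hkn hz,
    (SchwarzMeta.isBdryValue_polyF hh c hk hkn).hasBdryValue,
    SchwarzMeta.reDist_bdryValue_polyF hh c hk hkn, SchwarzMeta.im_polyF_zero hh c hk hkn⟩,
    ?_, hFn ▸ SchwarzMeta.contDiffOn_polyF hh c le_rfl, fun k hk => ?_⟩
  · have hs := SchwarzMeta.solvesMeta_exp_psi_mul_polyF hq hA.memLp hh c le_rfl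
    have e : SchwarzMeta.metaW A h c n
        = fun z => Complex.exp (SchwarzMeta.psi A z) * SchwarzMeta.polyF h c n z := by
      funext z
      rw [SchwarzMeta.metaW, SchwarzMeta.polyF_eq h c n hn]
    rwa [e]
  · have hEq := SchwarzMeta.iterate_dbar_polyF hh c hk (hFn ▸ fun z _ => rfl : EqOn F _ _)
    have hb := (SchwarzMeta.isBdryValue_polyF hh c (k := n - k) (by omega) (by omega)).hasBdryValue
    have hbF := hb.isBdryValue.congr hEq.symm
    refine ⟨hbF.hasBdryValue, by rw [hbF.bdryValue_eq],
      SchwarzMeta.reDist_bdryValue_polyF hh c (by omega) (by omega), ?_⟩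
    rw [hEq SchwarzMeta.zero_mem_D,
      SchwarzMeta.im_polyF_zero hh c (k := n - k) (by omega) (by omega)]
    congr 1
    omega
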